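/- Consider billiards in a regular pentagon. The \emph{double pentagon} is the translation surface made of a regular pentagon and its reflected copy, with opposite parallel edges glued by translation; each glued pair of edges carries one of five labels. A billiard trajectory is assumed not to hit a corner. It \emph{corresponds} to a linear trajectory on the double pentagon if the former is obtained from the latter by folding along each edge that is crossed. For a periodic billiard trajectory $\gamma$, its \emph{combinatorial length} $N(\gamma)$ is the number of bounces until it returns to the same point with the same direction, and its \emph{billiard sequence} is the bi-infinite sequence of edges it hits, whose length $M(\gamma)$ is the length of its shortest repeating block. The \emph{cutting sequence} of a trajectory $\tau$ on the double pentagon is the bi-infinite sequence of the labels of the edges it crosses; when it is periodic, its shortest repeating block is the cutting word of $\tau$, of length $\ell(\tau)$. Let $\gamma$ be a periodic billiard trajectory in the regular pentagon that is invariant, as a set, under the rotation of the pentagon by $2\pi/5$. Then $\gamma$ corresponds to some trajectory on the double pentagon, and for every trajectory $\tau$ on the double pentagon that corresponds to $\gamma$, the cutting sequence of $\tau$ is periodic and the following hold. 1. If $\gamma$ is not parallel to an edge of the pentagon, then $N(\gamma) = M(\gamma) = 5\,\ell(\tau)$. 2. If $\gamma$ is parallel to an edge of the pentagon, then its billiard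 sequence has half of this length, $M(\gamma) = \tfrac52\,\ell(\tau)$. The trajectory itself has half of this length, $N(\gamma)=\tfrac52\,\ell(\tau)$, if it is the central trajectory of its cylinder, i.e. if it bounces off the midpoint of an edge; otherwise $N(\gamma)=5\,\ell(\tau)$. -/

import Mathlib

noncomputable section

namespace PentagonBilliard

/-- The vertices of the regular pentagon inscribed in the unit circle of `ℂ`. -/
def vertex (k : ZMod 5) : ℂ :=
  Complex.exp (2 * Real.pi * Complex.I / 5) ^ k.val

/-- The relative interior of the edge number `k` of the pentagon. -/
def side (k : ZMod 5) : Set ℂ :=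
  openSegment ℝ (vertex k) (vertex (k + 1))

/-- The vector that joins the two ends of the edge number `k`. -/
def sideVec (k : ZMod 5) : ℂ := vertex (k + 1) - vertex k

/-- The midpoint of the edge number `k`. -/
def sideMid (k : ZMod 5) : ℂ := midpoint ℝ (vertex k) (vertex (k + 1))

/-- The minimal period of a bi-infinite sequence: the least `N > 0` such that shifting the sequence
by `N` does not change it (and `0` if the sequence is not periodic). -/
def seqPeriod {α : Type} (s : ℤ → α) : ℕ :=
  Function.minimalPeriod (fun (t : ℤ → α) (n : ℤ) => t (n + 1)) s

/-- An oriented, bi-infinite billiard trajectory in the regular pentagon that never hits a corner,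
given by its successive bounces: the `n`-th bounce takes place at the point `point n` in the
relative interior of the edge `edge n`, and at each bounce the outgoing direction is the mirror
image of the incoming direction in the line of that edge. -/
structure BilliardTrajectory where
  edge : ℤ → ZMod 5
  point : ℤ → ℂ
  point_mem : ∀ n, point n ∈ side (edge n)
  edge_ne : ∀ n, edge (n + 1) ≠ edge n
  reflect : ∀ n, SameRay ℝ
    ((Submodule.span ℝ {sideVec (edge (n + 1))}).reflection (point (n + 1) - point n))
    (point (n + 2) - point (n + 1))

namespace BilliardTrajectory

/-- The trajectory closes up. -/
def IsPeriodic (γ : BilliardTrajectory) : Prop :=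
  ∃ N : ℕ, 0 < N ∧ ∀ n, γ.point (n + N) = γ.point n

/-- The combinatorial length (period) of a periodic billiard trajectory: the number of bounces
until the trajectory returns to the same point with the same direction.  Two consecutive bounce
points determine the whole trajectory, so this is the minimal period of the sequence of bounce
points. -/
def combLength (γ : BilliardTrajectory) : ℕ := seqPeriod γ.point

/-- The length of the repeating block of the sequence of the edges that are hit. -/
def sequenceLength (γ : BilliardTrajectory) : ℕ := seqPeriod γ.edge

/-- The set of points of the table that the trajectory visits. -/
def trace (γ : BilliardTrajectory) : Set ℂ :=
  ⋃ n : ℤ, segment ℝ (γ.point n) (γ.point (n + 1))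

/-- The rotation of the table by `2π/5` maps the trajectory to itself. -/
def IsRotationallySymmetric (γ : BilliardTrajectory) : Prop :=
  (fun z : ℂ => Complex.exp (2 * Real.pi * Complex.I / 5) * z) '' γ.trace = γ.trace

/-- The trajectory travels parallel to an edge of the pentagon: one of its segments (equivalently,
each of them) is parallel to an edge. -/
def IsParallelToEdge (γ : BilliardTrajectory) : Prop :=
  ∃ (n : ℤ) (k : ZMod 5) (c : ℝ), γ.point (n + 1) - γ.point n = c • sideVec k

/-- The trajectory bounces off the midpoint of an edge. -/
def HitsMidpoint (γ : BilliardTrajectory) : Prop :=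
  ∃ n : ℤ, γ.point n = sideMid (γ.edge n)

end BilliardTrajectory

/-- The two pentagons of the double pentagon: `halfPentagon 1` is the pentagon itself and
`halfPentagon (-1)` is its image under `z ↦ -z`.  (As the pentagon is symmetric under a reflection,
this is a reflected copy as well.) -/
def halfPentagon (s : ℤˣ) : Set ℂ :=
  convexHull ℝ (Set.range fun k : ZMod 5 => ((s : ℤ) : ℂ) * vertex k)

/-- The relative interior of the edge of `halfPentagon s` that carries the label `k`. The edges with
label `k` of the two pentagons are parallel. -/
def halfSide (s : ℤˣ) (k : ZMod 5) : Set ℂ :=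
  (fun z : ℂ => ((s : ℤ) : ℂ) * z) '' side k

/-- The edge with label `k` of `halfPentagon s` is glued to the edge with label `k` of
`halfPentagon (-s)` by this translation. -/
def glue (s : ℤˣ) (k : ZMod 5) (z : ℂ) : ℂ :=
  z - 2 * (((s : ℤ) : ℂ) * sideMid k)

/-- An oriented, bi-infinite linear trajectory on the double pentagon surface that never hits a
corner.  Its `n`-th segment lies in `halfPentagon (half n)`; it has the constant direction `dir` and
runs from the point `entry n` of the edge `edge n` to the point `exit n` of the edge `edge (n + 1)`,
where it crosses into the other pentagon through the gluing. -/
structure DoublePentagonTrajectory where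
  dir : ℂ
  dir_ne : dir ≠ 0
  half : ℤ → ℤˣ
  edge : ℤ → ZMod 5
  entry : ℤ → ℂ
  exit : ℤ → ℂ
  edge_ne : ∀ n, edge (n + 1) ≠ edge n
  entry_mem : ∀ n, entry n ∈ halfSide (half n) (edge n)
  exit_mem : ∀ n, exit n ∈ halfSide (half n) (edge (n + 1))
  direction : ∀ n, SameRay ℝ dir (exit n - entry n)
  half_succ : ∀ n, half (n + 1) = -half n
  entry_succ : ∀ n, entry (n + 1) = glue (half n) (edge (n + 1)) (exit n)

namespace DoublePentagonTrajectory

/-- The cutting sequence: the bi-infinite sequence of the labels of the edges that are crossed. -/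
def cuttingSequence (τ : DoublePentagonTrajectory) : ℤ → ZMod 5 := τ.edge

/-- The length of the cutting word, the repeating block of the cutting sequence. -/
def wordLength (τ : DoublePentagonTrajectory) : ℕ := seqPeriod τ.cuttingSequence

/-- `τ` corresponds to the billiard trajectory `γ`: folding along each edge that `τ` crosses turns
`τ` into `γ`.  The map `F n` is the isometry by which the pentagon that contains the `n`-th segment
of `τ` is laid onto the table; consecutive ones agree along the edge that is crossed in between. -/
def FoldsTo (τ : DoublePentagonTrajectory) (γ : BilliardTrajectory) : Prop :=
  ∃ F : ℤ → (ℂ ≃ₗᵢ[ℝ] ℂ),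
    (∀ n, F n '' halfPentagon (τ.half n) = halfPentagon 1) ∧
    (∀ n, ∀ z ∈ halfSide (τ.half n) (τ.edge (n + 1)),
      F (n + 1) (glue (τ.half n) (τ.edge (n + 1)) z) = F n z) ∧
    (∀ n, F n (τ.entry n) = γ.point n)

end DoublePentagonTrajectory

end PentagonBilliard

end

namespace PentagonBilliard

open ComplexConjugate

/-! ### The vertices -/

/-! Edges and vertices are numbered by `ZMod 5`, and a fold of either half of the double pentagon
onto the table acts on edge numbers by `k ↦ σ * k + c` with `σ = ±1`. Consecutive folds have
opposite orientation (`FoldsTo.exists_sign`), so the increments of the billiard sequence are those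
of the cutting sequence multiplied by alternating signs. The theorem compares the periods of two
such sequences.

Rotational symmetry means that rotating by `2π/5` renumbers the bounces (`exists_shift_eq_rotate`).
In particular some shift adds `1` to every edge number. Let `p` be the period of the edge
increments; then a shift by `p` adds a constant `D ≠ 0`, and the billiard sequence has period `5 *
p`.

Suppose the trajectory is not parallel to an edge. Periodic trajectories with the same edges have
the same directions (`unitDir_eq`), so a shift by `p` rotates the direction by `vertex D`. An odd
number of bounces acts on directions as a reflection, and agreement of the two would force the
direction to be parallel to an edge; so `p` is even. The same comparison shows that the label does
not change over `p` steps, and a period of the labels must in turn be a multiple of `p`. Hence the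
cutting word has length `p`. Finally, an even period of the edges is a period of the bounce points
(`point_add_of_edge_add`).

If the trajectory is parallel to an edge, each chord is symmetric under a reflection of the
pentagon, so the edge number grows by a constant `δ ≠ 0`. The billiard sequence has period 5, and
the labels change by `±δ` alternately and have period 2. Five bounces reflect a bounce point in the
axis of its edge, so the points have period 5 if a midpoint is hit and 10 otherwise. -/

theorem vertex_zero : vertex 0 = 1 := by simp [vertex]

theorem vertex_add (a b : ZMod 5) : vertex (a + b) = vertex a * vertex b := by
  have h5 := (Complex.isPrimitiveRoot_exp 5 (by norm_num)).pow_eq_one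
  push_cast at h5
  unfold vertex
  rw [← pow_add, ZMod.val_add, ← pow_mod_orderOf _ (a.val + b.val),
    ← pow_mod_orderOf _ ((a.val + b.val) % 5), Nat.mod_mod_of_dvd _ (orderOf_dvd_of_pow_eq_one h5)]

theorem vertex_one : vertex 1 = Complex.exp (2 * Real.pi * Complex.I / 5) := by
  rw [vertex, show (1 : ZMod 5).val = 1 from rfl, pow_one]

theorem vertex_ne_zero (k : ZMod 5) : vertex k ≠ 0 := pow_ne_zero _ (Complex.exp_ne_zero _)

theorem vertex_neg (k : ZMod 5) : vertex (-k) = (vertex k)⁻¹ := by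
  refine eq_inv_of_mul_eq_one_left ?_
  rw [← vertex_add, neg_add_cancel, vertex_zero]

theorem vertex_sub (a b : ZMod 5) : vertex (a - b) = vertex a * vertex (-b) := by
  rw [sub_eq_add_neg, vertex_add]

theorem norm_vertex (k : ZMod 5) : ‖vertex k‖ = 1 := by
  have h : ‖Complex.exp (2 * Real.pi * Complex.I / 5)‖ = 1 := by
    rw [Complex.norm_exp]
    simp
  rw [vertex, norm_pow, h, one_pow]

theorem conj_vertex (k : ZMod 5) : conj (vertex k) = vertex (-k) := by
  rw [vertex_neg, Complex.inv_eq_conj (norm_vertex k)]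

theorem vertex_mul_vertex_neg (k : ZMod 5) : vertex k * vertex (-k) = 1 := by
  rw [← vertex_add, add_neg_cancel, vertex_zero]

theorem vertex_injective : Function.Injective vertex := by
  intro a b h
  have hp := Complex.isPrimitiveRoot_exp 5 (by norm_num)
  push_cast at hp
  exact ZMod.val_injective 5 (hp.pow_inj a.val_lt b.val_lt h)

theorem re_vertex_neg (k : ZMod 5) : (vertex (-k)).re = (vertex k).re := by
  rw [← conj_vertex, Complex.conj_re]

theorem re_vertex_one_pos : 0 < (vertex 1).re := by
  rw [vertex_one, show (2 * Real.pi * Complex.I / 5 : ℂ) = ((2 * Real.pi / 5 : ℝ) : ℂ) * Complex.I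
    by push_cast; ring, Complex.exp_ofReal_mul_I_re]
  apply Real.cos_pos_of_mem_Ioo
  constructor <;> linarith [Real.pi_pos]

theorem re_sq_add_im_sq_vertex (k : ZMod 5) : (vertex k).re ^ 2 + (vertex k).im ^ 2 = 1 := by
  have h := Complex.normSq_apply (vertex k)
  rw [Complex.normSq_eq_norm_sq, norm_vertex] at h
  linarith

theorem re_vertex_one_lt_one : (vertex 1).re < 1 := by
  have h := re_sq_add_im_sq_vertex 1
  refine lt_of_le_of_ne (by nlinarith [sq_nonneg (vertex 1).im]) fun h1 => ?_
  have h2 : (vertex 1).im = 0 := by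
    rw [h1] at h
    nlinarith
  have h3 : vertex 1 = vertex 0 := by
    rw [vertex_zero]
    exact Complex.ext h1 h2
  exact absurd (vertex_injective h3) (by decide)

theorem re_vertex_two : (vertex 2).re = 2 * (vertex 1).re ^ 2 - 1 := by
  have h := re_sq_add_im_sq_vertex 1
  rw [show (2 : ZMod 5) = 1 + 1 by decide, vertex_add, Complex.mul_re]
  nlinarith

theorem sideVec_eq (k : ZMod 5) : sideVec k = vertex k * (vertex 1 - 1) := by
  rw [sideVec, vertex_add]
  ring

theorem sideMid_eq (k : ZMod 5) : sideMid k = vertex k * (1 + vertex 1) / 2 := by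
  rw [sideMid, vertex_add, midpoint_eq_smul_add, invOf_eq_inv, Complex.real_smul]
  push_cast
  ring

theorem vertex_one_sub_one_ne_zero : vertex 1 - 1 ≠ 0 := by
  rw [← vertex_zero]
  exact sub_ne_zero.2 fun h => absurd (vertex_injective h) (by decide)

theorem sideVec_ne_zero (k : ZMod 5) : sideVec k ≠ 0 := by
  rw [sideVec_eq]
  exact mul_ne_zero (vertex_ne_zero k) vertex_one_sub_one_ne_zero

/-! ### The height over an edge -/

/-- The linear form on `ℂ` that is constant on the edge number `k` and positive on it. -/
noncomputable def height (k : ZMod 5) : ℂ →ₗ[ℝ] ℝ :=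
  Complex.reLm ∘ₗ LinearMap.mulLeft ℝ (vertex (-k) * (1 + vertex (-1)))

/-- The maximum of `height k` on the pentagon. -/
noncomputable def maxHeight : ℝ := 1 + (vertex 1).re

theorem height_apply (k : ZMod 5) (z : ℂ) :
    height k z = (vertex (-k) * (1 + vertex (-1)) * z).re := rfl

/-- The coefficient in `height k` is the conjugate of `vertex k + vertex (k + 1)`, so the height is
the inner product with the sum of the two ends of the edge. -/
theorem height_vertex (k j : ZMod 5) :
    height k (vertex j) = (vertex (j - k)).re + (vertex (j - k - 1)).re := by
  rw [height_apply, vertex_sub (j - k) 1, vertex_sub j k, ← Complex.add_re]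
  congr 1
  ring

theorem height_vertex_self (k : ZMod 5) : height k (vertex k) = maxHeight := by
  rw [height_vertex, sub_self, zero_sub, re_vertex_neg, vertex_zero, maxHeight, Complex.one_re]

theorem height_vertex_add_one (k : ZMod 5) : height k (vertex (k + 1)) = maxHeight := by
  rw [height_vertex, add_sub_cancel_left, sub_self, vertex_zero, maxHeight, Complex.one_re, add_comm]

theorem height_vertex_lt {k j : ZMod 5} (h : j ≠ k) (h' : j ≠ k + 1) :
    height k (vertex j) < maxHeight := by
  have h0 := re_vertex_one_pos
  have h1 := re_vertex_one_lt_one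
  have h2 := re_vertex_two
  have h3 : (vertex 3).re = (vertex 2).re := by
    rw [← re_vertex_neg 2]
    rfl
  have h4 : (vertex 4).re = (vertex 1).re := by
    rw [← re_vertex_neg 1]
    rfl
  have key : ∀ i : ZMod 5, i ≠ 0 → i ≠ 1 → (vertex i).re + (vertex (i - 1)).re < maxHeight := by
    intro i hi0 hi1
    have : i = 2 ∨ i = 3 ∨ i = 4 := by
      revert i
      decide
    unfold maxHeight
    rcases this with rfl | rfl | rfl
    · rw [show (2 - 1 : ZMod 5) = 1 by decide]
      nlinarith
    · rw [show (3 - 1 : ZMod 5) = 2 by decide]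
      nlinarith
    · rw [show (4 - 1 : ZMod 5) = 3 by decide]
      nlinarith
  rw [height_vertex]
  exact key _ (sub_ne_zero.2 h) fun h5 => h' (by rw [← h5]; ring)

theorem height_vertex_le (k j : ZMod 5) : height k (vertex j) ≤ maxHeight := by
  by_cases h : j = k
  · rw [h, height_vertex_self]
  by_cases h' : j = k + 1
  · rw [h', height_vertex_add_one]
  exact (height_vertex_lt h h').le

theorem mem_side {k : ZMod 5} {z : ℂ} : z ∈ side k ↔
    ∃ a b : ℝ, 0 < a ∧ 0 < b ∧ a + b = 1 ∧ a • vertex k + b • vertex (k + 1) = z := Iff.rfl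

theorem height_le_of_mem_side (k : ZMod 5) {j : ZMod 5} {z : ℂ} (hz : z ∈ side j) :
    height k z ≤ maxHeight := by
  obtain ⟨a, b, ha, hb, hab, rfl⟩ := mem_side.1 hz
  rw [map_add, map_smul, map_smul, smul_eq_mul, smul_eq_mul]
  have h1 := height_vertex_le k j
  have h2 := height_vertex_le k (j + 1)
  calc a * height k (vertex j) + b * height k (vertex (j + 1))
      ≤ a * maxHeight + b * maxHeight := by gcongr
    _ = maxHeight := by rw [← add_mul, hab, one_mul]

theorem height_of_mem_side {k : ZMod 5} {z : ℂ} (hz : z ∈ side k) : height k z = maxHeight := by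
  obtain ⟨a, b, ha, hb, hab, rfl⟩ := mem_side.1 hz
  rw [map_add, map_smul, map_smul, smul_eq_mul, smul_eq_mul, height_vertex_self,
    height_vertex_add_one, ← add_mul, hab, one_mul]

/-- A convex combination with positive weights attains the maximum only if both ends do, and edge
`k` is the only edge with this property. -/
theorem eq_of_height_eq {k j : ZMod 5} {z : ℂ} (hz : z ∈ side j) (h : height k z = maxHeight) :
    j = k := by
  obtain ⟨a, b, ha, hb, hab, rfl⟩ := mem_side.1 hz
  rw [map_add, map_smul, map_smul, smul_eq_mul, smul_eq_mul] at h
  have h1 := height_vertex_le k j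
  have h2 := height_vertex_le k (j + 1)
  have hs : a * maxHeight + b * maxHeight = maxHeight := by rw [← add_mul, hab, one_mul]
  by_contra hne
  by_cases h3 : j = k + 1
  · have h4 : height k (vertex (j + 1)) < maxHeight := by
      subst h3
      apply height_vertex_lt
      · rw [add_assoc, Ne, add_eq_left]
        decide
      · rw [Ne, add_eq_left]
        decide
    linarith [mul_le_mul_of_nonneg_left h1 ha.le, mul_lt_mul_of_pos_left h4 hb]
  · have h4 := height_vertex_lt hne h3
    linarith [mul_lt_mul_of_pos_left h4 ha, mul_le_mul_of_nonneg_left h2 hb.le]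

theorem height_lt_of_mem_side {k j : ZMod 5} {z : ℂ} (hz : z ∈ side j) (h : j ≠ k) :
    height k z < maxHeight :=
  lt_of_le_of_ne (height_le_of_mem_side k hz) fun h' => h (eq_of_height_eq hz h')

theorem eq_of_mem_side {k j : ZMod 5} {z : ℂ} (hj : z ∈ side j) (hk : z ∈ side k) : j = k :=
  eq_of_height_eq hj (height_of_mem_side hk)

theorem height_sideVec (k : ZMod 5) : height k (sideVec k) = 0 := by
  rw [sideVec, map_sub, height_vertex_self, height_vertex_add_one, sub_self]

theorem sideMid_mem_side (k : ZMod 5) : sideMid k ∈ side k := by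
  refine ⟨1 / 2, 1 / 2, by norm_num, by norm_num, by norm_num, ?_⟩
  rw [sideMid, midpoint_eq_smul_add, smul_add]
  norm_num

theorem mul_mem_side (c : ZMod 5) {k : ZMod 5} {z : ℂ} (hz : z ∈ side k) :
    vertex c * z ∈ side (k + c) := by
  obtain ⟨a, b, ha, hb, hab, rfl⟩ := mem_side.1 hz
  refine mem_side.2 ⟨a, b, ha, hb, hab, ?_⟩
  rw [add_right_comm k c 1, vertex_add, vertex_add (k + 1)]
  simp only [Complex.real_smul]
  ring

theorem conj_mem_side (c : ZMod 5) {k : ZMod 5} {z : ℂ} (hz : z ∈ side k) :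
    vertex (c + 1) * conj z ∈ side (c - k) := by
  obtain ⟨a, b, ha, hb, hab, rfl⟩ := mem_side.1 hz
  refine mem_side.2 ⟨b, a, hb, ha, by rw [add_comm, hab], ?_⟩
  simp only [Complex.real_smul, map_add, map_mul, Complex.conj_ofReal, conj_vertex]
  rw [show c - k = c + 1 + -(k + 1) by ring, show c + 1 + -(k + 1) + 1 = c + 1 + -k by ring,
    vertex_add (c + 1), vertex_add (c + 1)]
  ring

theorem sub_eq_smul_sideVec {k : ZMod 5} {y z : ℂ} (hy : y ∈ side k) (hz : z ∈ side k) :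
    ∃ c : ℝ, y - z = c • sideVec k := by
  obtain ⟨a, b, -, -, hab, rfl⟩ := mem_side.1 hy
  obtain ⟨a', b', -, -, hab', rfl⟩ := mem_side.1 hz
  refine ⟨b - b', ?_⟩
  obtain rfl := eq_sub_of_add_eq hab
  obtain rfl := eq_sub_of_add_eq hab'
  simp only [Complex.real_smul, sideVec]
  push_cast
  ring

/-- A line through the relative interiors of two different edges meets no other edge. -/
theorem eq_or_eq_of_mem_line {i j k : ZMod 5} {P Q z : ℂ} (hP : P ∈ side i) (hQ : Q ∈ side j)
    (hij : i ≠ j) (hz : z ∈ side k) {s : ℝ} (hs : z = P + s • (Q - P)) : z = P ∨ z = Q := by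
  have h1 : ∀ l, height l z = height l P + s * (height l Q - height l P) := fun l => by
    rw [hs, map_add, map_smul, map_sub, smul_eq_mul]
  have h2 : 0 ≤ s := by
    have := h1 i
    rw [height_of_mem_side hP] at this
    have h3 := height_le_of_mem_side i hz
    have h4 := height_lt_of_mem_side hQ hij.symm
    nlinarith
  have h3 : s ≤ 1 := by
    have := h1 j
    rw [height_of_mem_side hQ] at this
    have h3 := height_le_of_mem_side j hz
    have h4 := height_lt_of_mem_side hP hij
    nlinarith
  rcases h2.eq_or_lt with rfl | h2
  · left
    rw [hs, zero_smul, add_zero]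
  rcases h3.eq_or_lt with rfl | h3
  · right
    rw [hs, one_smul, add_sub_cancel]
  exfalso
  -- At an interior parameter a maximal height over `k` forces maximal height at both ends, which
  -- would then lie on the same edge.
  have h4 := h1 k
  rw [height_of_mem_side hz] at h4
  have h5 := height_le_of_mem_side k hP
  have h6 := height_le_of_mem_side k hQ
  have h7 : height k P = maxHeight := by nlinarith
  have h8 : height k Q = maxHeight := by nlinarith
  exact hij ((eq_of_height_eq hP h7).trans (eq_of_height_eq hQ h8).symm)

/-! ### Reflections -/

theorem conj_sideVec (k : ZMod 5) : conj (sideVec k) = -vertex (-(2 * k + 1)) * sideVec k := by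
  rw [sideVec_eq, map_mul, map_sub, conj_vertex, conj_vertex, map_one,
    show -(2 * k + 1) = -k + -k + -1 by ring, vertex_add, vertex_add]
  linear_combination vertex (-k) * vertex (-1) * (vertex 1 - 1) * vertex_mul_vertex_neg k +
    vertex (-k) * vertex_mul_vertex_neg 1

/-- Reflection in the line spanned by `w` is `z ↦ (w / conj w) * conj z`, and for `w = sideVec k`
this quotient is `-vertex (2 * k + 1)`. -/
theorem reflection_apply (k : ZMod 5) (z : ℂ) :
    (Submodule.span ℝ {sideVec k}).reflection z = -vertex (2 * k + 1) * conj z := by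
  have h0 := sideVec_ne_zero k
  have hc := conj_sideVec k
  have h1 : ((‖sideVec k‖ : ℂ)) ^ 2 = conj (sideVec k) * sideVec k := (Complex.conj_mul' _).symm
  have h2 : ((inner ℝ (sideVec k) z : ℝ) : ℂ) =
      (conj (sideVec k) * z + sideVec k * conj z) / 2 := by
    rw [Complex.inner, Complex.re_eq_add_conj, map_mul, Complex.conj_conj]
    ring
  have h3 := vertex_mul_vertex_neg (2 * k + 1)
  have h4 := vertex_ne_zero (-(2 * k + 1))
  rw [Submodule.reflection_singleton_apply, Complex.real_smul, nsmul_eq_mul]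
  push_cast
  erw [h1, h2, hc]
  field_simp
  linear_combination conj z * h3

/-- The reflection in the direction of the edge number `k`. -/
noncomputable def edgeRefl (k : ZMod 5) (z : ℂ) : ℂ := -vertex (2 * k + 1) * conj z

theorem edgeRefl_sub (k : ZMod 5) (y z : ℂ) : edgeRefl k (y - z) = edgeRefl k y - edgeRefl k z := by
  rw [edgeRefl, edgeRefl, edgeRefl, map_sub, mul_sub]

theorem edgeRefl_neg (k : ZMod 5) (z : ℂ) : edgeRefl k (-z) = -edgeRefl k z := by
  rw [edgeRefl, edgeRefl, map_neg, mul_neg]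

theorem edgeRefl_smul (k : ZMod 5) (c : ℝ) (z : ℂ) : edgeRefl k (c • z) = c • edgeRefl k z := by
  rw [edgeRefl, edgeRefl, Complex.real_smul, Complex.real_smul, map_mul, Complex.conj_ofReal]
  ring

theorem edgeRefl_edgeRefl (k : ZMod 5) (z : ℂ) : edgeRefl k (edgeRefl k z) = z := by
  rw [edgeRefl, edgeRefl, map_mul, map_neg, conj_vertex, Complex.conj_conj]
  linear_combination z * vertex_mul_vertex_neg (2 * k + 1)

theorem norm_edgeRefl (k : ZMod 5) (z : ℂ) : ‖edgeRefl k z‖ = ‖z‖ := by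
  rw [edgeRefl, norm_mul, norm_neg, norm_vertex, one_mul, Complex.norm_conj]

theorem edgeRefl_sideVec (k : ZMod 5) : edgeRefl k (sideVec k) = sideVec k := by
  rw [edgeRefl, conj_sideVec]
  linear_combination sideVec k * vertex_mul_vertex_neg (2 * k + 1)

theorem edgeRefl_sub_of_mem_side {k : ZMod 5} {y z : ℂ} (hy : y ∈ side k) (hz : z ∈ side k) :
    edgeRefl k (y - z) = y - z := by
  obtain ⟨c, hc⟩ := sub_eq_smul_sideVec hy hz
  rw [hc, edgeRefl_smul, edgeRefl_sideVec]

theorem edgeRefl_mul_vertex (k c : ZMod 5) (z : ℂ) :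
    edgeRefl (k + c) (vertex c * z) = vertex c * edgeRefl k z := by
  rw [edgeRefl, edgeRefl, map_mul, conj_vertex, show 2 * (k + c) + 1 = 2 * k + 1 + c + c by ring,
    vertex_add, vertex_add]
  linear_combination (-vertex (2 * k + 1) * vertex c * conj z) * vertex_mul_vertex_neg c

theorem sameRay_edgeRefl (k : ZMod 5) {y z : ℂ} (h : SameRay ℝ y z) :
    SameRay ℝ (edgeRefl k y) (edgeRefl k z) := by
  have := h.map (((Submodule.span ℝ {sideVec k}).reflection.toLinearEquiv : ℂ →ₗ[ℝ] ℂ))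
  simpa [reflection_apply, edgeRefl] using this

theorem sameRay_vertex_mul (k : ZMod 5) {y z : ℂ} (h : SameRay ℝ y z) :
    SameRay ℝ (vertex k * y) (vertex k * z) :=
  h.map (LinearMap.mulLeft ℝ (vertex k))

/-! ### Determinism and symmetries of billiard trajectories -/

namespace BilliardTrajectory

variable (γ : BilliardTrajectory)

theorem sameRay_edgeRefl (n : ℤ) :
    SameRay ℝ (edgeRefl (γ.edge (n + 1)) (γ.point (n + 1) - γ.point n))
      (γ.point (n + 2) - γ.point (n + 1)) := by
  have h := γ.reflect n
  rwa [reflection_apply] at h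

theorem point_ne (n : ℤ) : γ.point (n + 1) ≠ γ.point n := fun h =>
  γ.edge_ne n (eq_of_mem_side (h ▸ γ.point_mem (n + 1)) (γ.point_mem n))

theorem edge_eq_of_point_eq {γ γ' : BilliardTrajectory} {n m : ℤ} (h : γ.point n = γ'.point m) :
    γ.edge n = γ'.edge m :=
  eq_of_mem_side (γ.point_mem n) (h ▸ γ'.point_mem m)

/-- The trajectory with the bounces renumbered. -/
def shift (m : ℤ) : BilliardTrajectory where
  edge n := γ.edge (n + m)
  point n := γ.point (n + m)
  point_mem n := γ.point_mem _
  edge_ne n := by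
    rw [add_right_comm]
    exact γ.edge_ne _
  reflect n := by
    rw [add_right_comm n 1, add_right_comm n 2]
    exact γ.reflect _

/-- The image of the trajectory under a rotation of the table. -/
noncomputable def rotate (c : ZMod 5) : BilliardTrajectory where
  edge n := γ.edge n + c
  point n := vertex c * γ.point n
  point_mem n := mul_mem_side c (γ.point_mem n)
  edge_ne n := by
    rw [Ne, add_left_inj]
    exact γ.edge_ne n
  reflect n := by
    rw [reflection_apply, ← mul_sub, ← mul_sub]
    change SameRay ℝ (edgeRefl (γ.edge (n + 1) + c) (vertex c * _)) _
    rw [edgeRefl_mul_vertex]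
    exact sameRay_vertex_mul c (γ.sameRay_edgeRefl n)

/-- The trajectory travelled backwards. -/
def reverse : BilliardTrajectory where
  edge n := γ.edge (-n)
  point n := γ.point (-n)
  point_mem n := γ.point_mem _
  edge_ne n := by
    have := (γ.edge_ne (-(n + 1))).symm
    rwa [show -(n + 1) + 1 = -n by ring] at this
  reflect n := by
    have h := PentagonBilliard.sameRay_edgeRefl (γ.edge (-(n + 1))) (γ.sameRay_edgeRefl (-(n + 2)))
    rw [show -(n + 2) + 1 = -(n + 1) by ring, show -(n + 2) + 2 = -n by ring,
      edgeRefl_edgeRefl] at h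
    rw [reflection_apply]
    change SameRay ℝ (edgeRefl _ _) _
    rw [← sameRay_neg_iff, ← edgeRefl_neg, neg_sub, neg_sub]
    exact h.symm

/-- The reflection law fixes the outgoing ray, and a line through two different edges has no third
point on the boundary. -/
theorem point_succ_eq {γ γ' : BilliardTrajectory} (n : ℤ) (h : γ.point n = γ'.point n)
    (h1 : γ.point (n + 1) = γ'.point (n + 1)) : γ.point (n + 2) = γ'.point (n + 2) := by
  have e1 := edge_eq_of_point_eq h1
  have h2 := γ.sameRay_edgeRefl n
  have h3 := γ'.sameRay_edgeRefl n
  rw [← h, ← h1, ← e1] at h3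
  have n1 := γ.point_ne (n + 1)
  have n2 := γ'.point_ne (n + 1)
  rw [add_assoc, show (1 + 1 : ℤ) = 2 by norm_num] at n1 n2
  rw [← h1] at n2
  have h4 : SameRay ℝ (γ.point (n + 2) - γ.point (n + 1)) (γ'.point (n + 2) - γ.point (n + 1)) := by
    refine h2.symm.trans h3 fun h0 => ?_
    exfalso
    have h5 := congrArg norm h0
    rw [norm_edgeRefl, norm_zero, norm_eq_zero, sub_eq_zero] at h5
    exact γ.point_ne n h5
  obtain ⟨r, -, hr⟩ := h4.exists_pos_left (sub_ne_zero.2 n1) (sub_ne_zero.2 n2)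
  have e2 := γ.edge_ne (n + 1)
  rw [add_assoc, show (1 + 1 : ℤ) = 2 by norm_num] at e2
  rcases eq_or_eq_of_mem_line (γ.point_mem (n + 1)) (γ.point_mem (n + 2)) e2.symm
    (γ'.point_mem (n + 2)) (s := r) (by rw [hr]; ring) with h6 | h6
  · exact absurd h6 n2
  · exact h6.symm

theorem point_eq_nat {γ γ' : BilliardTrajectory} (h : γ.point 0 = γ'.point 0)
    (h1 : γ.point 1 = γ'.point 1) (n : ℕ) : γ.point n = γ'.point n := by
  have : γ.point n = γ'.point n ∧ γ.point (n + 1) = γ'.point (n + 1) := by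
    induction n with
    | zero => exact ⟨h, h1⟩
    | succ k ih =>
      push_cast
      refine ⟨ih.2, ?_⟩
      rw [add_assoc]
      exact point_succ_eq _ ih.1 ih.2
  exact this.1

/-- Two consecutive bounce points determine the trajectory. -/
theorem point_eq {γ γ' : BilliardTrajectory} (h : γ.point 0 = γ'.point 0)
    (h1 : γ.point 1 = γ'.point 1) (n : ℤ) : γ.point n = γ'.point n := by
  rcases Int.eq_nat_or_neg n with ⟨k, rfl | rfl⟩
  · exact point_eq_nat h h1 k
  -- The reversed trajectories are renumbered to start with bounces `1, 0`; their bounce `k + 1` is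
  -- the original bounce `-k`.
  · have h2 := point_eq_nat (γ := (γ.shift 1).reverse) (γ' := (γ'.shift 1).reverse)
      (by simpa [reverse, shift] using h1) (by simpa [reverse, shift] using h) (k + 1)
    simpa [reverse, shift] using h2

/-- A segment has uncountably many points while the trace is a countable union of chords, so two of
the points share a chord. -/
theorem exists_segment_of_subset_trace {P Q : ℂ} (hPQ : P ≠ Q) (h : segment ℝ P Q ⊆ γ.trace) :
    ∃ n : ℤ, ∃ y z : ℂ, y ≠ z ∧ y ∈ segment ℝ P Q ∧ z ∈ segment ℝ P Q ∧
      y ∈ segment ℝ (γ.point n) (γ.point (n + 1)) ∧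
      z ∈ segment ℝ (γ.point n) (γ.point (n + 1)) := by
  have hm : ∀ t : Set.Icc (0 : ℝ) 1, AffineMap.lineMap P Q (t : ℝ) ∈ segment ℝ P Q := fun t => by
    rw [segment_eq_image_lineMap]
    exact Set.mem_image_of_mem _ t.2
  choose f hf using fun t => Set.mem_iUnion.1 (h (hm t))
  have hni : ¬ Function.Injective f := fun hinj => by
    have hc : Countable (Set.Icc (0 : ℝ) 1) := hinj.countable
    have := Cardinal.le_aleph0_iff_set_countable.2 (Set.countable_coe_iff.1 hc)
    rw [Cardinal.mk_Icc_real zero_lt_one] at this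
    exact absurd Cardinal.aleph0_lt_continuum this.not_gt
  rw [Function.Injective] at hni
  push Not at hni
  obtain ⟨s, t, hst, hne⟩ := hni
  refine ⟨f s, _, _, fun heq => hne ?_, hm s, hm t, hf s, hst ▸ hf t⟩
  exact Subtype.ext (AffineMap.lineMap_injective ℝ hPQ heq)

/-- Two distinct common points put both chords on one line, and that line meets the edges only in
the two ends of a chord. -/
theorem endpoints_of_common_points {i j i' j' : ZMod 5} {P Q P' Q' y z : ℂ} (hP : P ∈ side i)
    (hQ : Q ∈ side j) (hij : i ≠ j) (hP' : P' ∈ side i') (hQ' : Q' ∈ side j') (hij' : i' ≠ j')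
    (hyz : y ≠ z) (hy : y ∈ segment ℝ P Q) (hz : z ∈ segment ℝ P Q)
    (hy' : y ∈ segment ℝ P' Q') (hz' : z ∈ segment ℝ P' Q') :
    P' = P ∧ Q' = Q ∨ P' = Q ∧ Q' = P := by
  rw [segment_eq_image'] at hy hz hy' hz'
  obtain ⟨a, -, ha⟩ := hy
  obtain ⟨b, -, hb⟩ := hz
  obtain ⟨a', -, ha'⟩ := hy'
  obtain ⟨b', -, hb'⟩ := hz'
  simp only at ha hb ha' hb'
  have hab : a' - b' ≠ 0 := by
    intro h
    apply hyz
    rw [← ha', ← hb', sub_eq_zero.1 h]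
  have hne : P' ≠ Q' := fun h => hij' (eq_of_mem_side (h ▸ hP') hQ')
  have h1 : (a' - b') • (Q' - P') = (a - b) • (Q - P) := by
    rw [sub_smul, sub_smul]
    linear_combination ha' - hb' - ha + hb
  have h2 : Q' - P' = ((a' - b')⁻¹ * (a - b)) • (Q - P) := by
    rw [mul_smul, ← h1, smul_smul, inv_mul_cancel₀ hab, one_smul]
  have h3 : P' = P + (a - a' * ((a' - b')⁻¹ * (a - b))) • (Q - P) := by
    rw [sub_smul, mul_smul, ← h2]
    linear_combination ha' - ha
  have h4 : Q' = P + (a - a' * ((a' - b')⁻¹ * (a - b)) + (a' - b')⁻¹ * (a - b)) • (Q - P) := by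
    rw [add_smul, ← h2]
    linear_combination h3
  rcases eq_or_eq_of_mem_line hP hQ hij hP' h3 with h5 | h5 <;>
    rcases eq_or_eq_of_mem_line hP hQ hij hQ' h4 with h6 | h6
  · exact absurd (h5.trans h6.symm) hne
  · exact Or.inl ⟨h5, h6⟩
  · exact Or.inr ⟨h5, h6⟩
  · exact absurd (h5.trans h6.symm) hne

/-- A rotationally symmetric trajectory is rotated by a shift of its bounces. -/
theorem exists_shift_eq_rotate (h : γ.IsRotationallySymmetric) :
    ∃ m : ℤ, ∀ n, γ.point (n + m) = vertex 1 * γ.point n := by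
  have hne : (γ.rotate 1).point 0 ≠ (γ.rotate 1).point 1 := ((γ.rotate 1).point_ne 0).symm
  have hsub : segment ℝ ((γ.rotate 1).point 0) ((γ.rotate 1).point 1) ⊆ γ.trace := by
    rw [← h, ← vertex_one]
    have h1 : segment ℝ (γ.point 0) (γ.point (0 + 1)) ⊆ γ.trace :=
      Set.subset_iUnion (fun n : ℤ => segment ℝ (γ.point n) (γ.point (n + 1))) 0
    refine subset_trans ?_ (Set.image_mono h1)
    have h2 := image_segment ℝ (LinearMap.mulLeft ℝ (vertex 1)).toAffineMap (γ.point 0)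
      (γ.point (0 + 1))
    exact h2.ge
  obtain ⟨m, y, z, hyz, h1, h2, h3, h4⟩ := γ.exists_segment_of_subset_trace hne hsub
  rcases endpoints_of_common_points ((γ.rotate 1).point_mem 0) ((γ.rotate 1).point_mem 1)
    ((γ.rotate 1).edge_ne 0).symm (γ.point_mem m) (γ.point_mem (m + 1)) (γ.edge_ne m).symm hyz
    h1 h2 h3 h4 with ⟨h5, h6⟩ | ⟨h5, h6⟩
  · refine ⟨m, fun n => point_eq (γ := γ.shift m) (γ' := γ.rotate 1) ?_ ?_ n⟩
    · simpa [shift] using h5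
    · simpa [shift, add_comm] using h6
  -- If the rotation reversed the direction of travel, applying it twice would bring every bounce
  -- back to itself. But it also adds `2` to the edge number.
  · exfalso
    have h7 : ∀ n, γ.point (-n + (m + 1)) = vertex 1 * γ.point n := fun n =>
      point_eq (γ := (γ.shift (m + 1)).reverse) (γ' := γ.rotate 1)
        (by simpa [shift, reverse] using h6) (by simpa [shift, reverse] using h5) n
    have h8 := h7 (-0 + (m + 1))
    rw [h7 0] at h8
    have h9 := edge_eq_of_point_eq (γ := γ) (γ' := γ.rotate (1 + 1)) (n := 0) (m := 0) (by
      change _ = vertex (1 + 1) * _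
      rw [vertex_add, mul_assoc, ← h8]
      congr 1
      ring)
    change _ = _ + _ at h9
    rw [left_eq_add] at h9
    exact absurd h9 (by decide)

end BilliardTrajectory

/-! ### Bi-infinite sequences -/

/-- This remains true for a sequence without period: `seqPeriod s` is then `0`, which divides only
`0`. -/
theorem seqPeriod_dvd_iff {α : Type} (s : ℤ → α) (k : ℕ) :
    seqPeriod s ∣ k ↔ ∀ n, s (n + k) = s n := by
  have h : ∀ k : ℕ, (fun (t : ℤ → α) (n : ℤ) => t (n + 1))^[k] s = fun n => s (n + k) := by
    intro k
    induction k with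
    | zero => simp
    | succ k ih =>
      rw [Function.iterate_succ_apply', ih]
      funext n
      push_cast
      congr 1
      ring
  rw [seqPeriod, ← Function.isPeriodicPt_iff_minimalPeriod_dvd, Function.IsPeriodicPt,
    Function.IsFixedPt, h, funext_iff]

theorem seqPeriod_eq {α : Type} {s : ℤ → α} {q : ℕ} (h : ∀ k : ℕ, (∀ n, s (n + k) = s n) ↔ q ∣ k) :
    seqPeriod s = q :=
  Nat.dvd_antisymm ((seqPeriod_dvd_iff s q).2 ((h q).2 dvd_rfl))
    ((h _).1 ((seqPeriod_dvd_iff s _).1 dvd_rfl))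

theorem forall_int_of_iff_succ {P : ℤ → Prop} (h : ∀ n, P n ↔ P (n + 1)) {m : ℤ} (hm : P m)
    (n : ℤ) : P n := by
  induction n using Int.inductionOn' (b := m) with
  | zero => exact hm
  | succ k _ ih => exact (h k).1 ih
  | pred k _ ih => exact (h (k - 1)).2 (by rwa [sub_add_cancel])

theorem apply_add_mul {A : Type*} [AddCommGroup A] {s : ℤ → A} {q : ℕ} {D : A}
    (h : ∀ n, s (n + q) = s n + D) (j : ℕ) (n : ℤ) : s (n + (q * j : ℕ)) = s n + j • D := by
  induction j with
  | zero => simp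
  | succ j ih =>
    rw [succ_nsmul, ← add_assoc, ← ih, ← h]
    congr 1
    push_cast
    ring

/-! ### Invariants under reflections -/

theorem inner_edgeRefl (k : ZMod 5) (y z : ℂ) :
    inner ℝ (edgeRefl k y) (edgeRefl k z) = inner ℝ y z := by
  rw [Complex.inner, Complex.inner, edgeRefl, edgeRefl, map_mul, map_neg, conj_vertex,
    Complex.conj_conj, ← Complex.conj_re (z * conj y), map_mul, Complex.conj_conj]
  congr 1
  linear_combination (y * conj z) * vertex_mul_vertex_neg (2 * k + 1)

/-- The expression is the oriented area form, whose sign a reflection changes. -/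
theorem im_conj_mul_edgeRefl (k : ZMod 5) (y z : ℂ) :
    (conj (edgeRefl k y) * edgeRefl k z).im = -(conj y * z).im := by
  rw [edgeRefl, edgeRefl, map_mul, map_neg, conj_vertex,
    Complex.conj_conj, ← Complex.conj_im (conj y * z), map_mul, Complex.conj_conj]
  congr 1
  linear_combination (y * conj z) * vertex_mul_vertex_neg (2 * k + 1)

theorem edgeRefl_sideVec' (i k : ZMod 5) : edgeRefl i (sideVec k) = sideVec (2 * i - k) := by
  rw [edgeRefl, conj_sideVec, sideVec_eq, sideVec_eq,
    show 2 * i - k = 2 * i + 1 + -(2 * k + 1) + k by ring, vertex_add _ k, vertex_add (2 * i + 1)]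
  ring

theorem exists_smul_sideVec_of_edgeRefl_eq {k : ZMod 5} {z : ℂ} (h : edgeRefl k z = z) :
    ∃ c : ℝ, z = c • sideVec k := by
  have h0 := sideVec_ne_zero k
  have hr := edgeRefl_sideVec k
  have hz : conj (z / sideVec k) = z / sideVec k := by
    have h1 : conj (sideVec k) ≠ 0 := (map_ne_zero _).2 h0
    rw [edgeRefl] at h hr
    rw [map_div₀]
    conv_rhs => rw [← h, ← hr]
    rw [mul_div_mul_left _ _ (neg_ne_zero.2 (vertex_ne_zero _))]
  obtain ⟨c, hc⟩ := Complex.conj_eq_iff_real.1 hz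
  exact ⟨c, by rw [Complex.real_smul, ← hc, div_mul_cancel₀ _ h0]⟩

theorem edgeRefl_two (i j : ZMod 5) (z : ℂ) :
    edgeRefl j (edgeRefl i z) = vertex (2 * (j - i)) * z := by
  rw [edgeRefl, edgeRefl, map_mul, map_neg, conj_vertex, Complex.conj_conj,
    show 2 * (j - i) = 2 * j + 1 + -(2 * i + 1) by ring, vertex_add (2 * j + 1)]
  ring

/-! ### Directions, and rigidity of periodic trajectories with the same edges -/

namespace BilliardTrajectory

/-- The unit vector in the direction in which the trajectory leaves its `n`-th bounce. -/
noncomputable def unitDir (γ : BilliardTrajectory) (n : ℤ) : ℂ :=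
  ‖γ.point (n + 1) - γ.point n‖⁻¹ • (γ.point (n + 1) - γ.point n)

/-- The length of the segment from the `n`-th bounce to the next one. -/
noncomputable def stepLength (γ : BilliardTrajectory) (n : ℤ) : ℝ :=
  ‖γ.point (n + 1) - γ.point n‖

variable (γ : BilliardTrajectory)

theorem stepLength_pos (n : ℤ) : 0 < γ.stepLength n :=
  norm_pos_iff.2 (sub_ne_zero.2 (γ.point_ne n))

theorem norm_unitDir (n : ℤ) : ‖γ.unitDir n‖ = 1 := by
  have h : ‖γ.point (n + 1) - γ.point n‖ ≠ 0 := (γ.stepLength_pos n).ne'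
  rw [unitDir, norm_smul, norm_inv, norm_norm, inv_mul_cancel₀ h]

theorem unitDir_ne_zero (n : ℤ) : γ.unitDir n ≠ 0 :=
  norm_ne_zero_iff.1 (by rw [norm_unitDir]; exact one_ne_zero)

theorem point_sub_eq (n : ℤ) :
    γ.point (n + 1) - γ.point n = γ.stepLength n • γ.unitDir n := by
  have h : ‖γ.point (n + 1) - γ.point n‖ ≠ 0 := (γ.stepLength_pos n).ne'
  rw [unitDir, stepLength, smul_smul, mul_inv_cancel₀ h, one_smul]

theorem unitDir_succ (n : ℤ) : γ.unitDir (n + 1) = edgeRefl (γ.edge (n + 1)) (γ.unitDir n) := by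
  have h := γ.sameRay_edgeRefl n
  have h1 := γ.point_ne (n + 1)
  rw [show (n + 2 : ℤ) = n + 1 + 1 by ring] at h
  have h2 := (sameRay_iff_inv_norm_smul_eq_of_ne (norm_ne_zero_iff.1
    (by rw [norm_edgeRefl]; exact (γ.stepLength_pos n).ne')) (sub_ne_zero.2 h1)).1 h
  rw [unitDir, unitDir, edgeRefl_smul, ← h2, norm_edgeRefl]

theorem unitDir_add_two (n : ℤ) :
    γ.unitDir (n + 2) = vertex (2 * (γ.edge (n + 2) - γ.edge (n + 1))) * γ.unitDir n := by
  rw [show n + 2 = n + 1 + 1 by ring, unitDir_succ, unitDir_succ, edgeRefl_two]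

theorem unitDir_add_even (n : ℤ) (j : ℕ) :
    ∃ a, γ.unitDir (n + (2 * j : ℕ)) = vertex a * γ.unitDir n := by
  induction j with
  | zero => exact ⟨0, by simp [vertex_zero]⟩
  | succ j ih =>
    obtain ⟨a, ha⟩ := ih
    have h := γ.unitDir_add_two (n + (2 * j : ℕ))
    rw [ha, ← mul_assoc, ← vertex_add] at h
    exact ⟨_, by rw [← h]; congr 1; push_cast; ring⟩

theorem unitDir_add_odd (n : ℤ) (j : ℕ) :
    ∃ a, γ.unitDir (n + (2 * j + 1 : ℕ)) = -vertex a * conj (γ.unitDir n) := by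
  obtain ⟨a, ha⟩ := γ.unitDir_add_even n j
  have h := γ.unitDir_succ (n + (2 * j : ℕ))
  rw [ha, edgeRefl, map_mul, conj_vertex, ← mul_assoc, neg_mul, ← vertex_add] at h
  exact ⟨_, by rw [← h]; push_cast; rw [add_assoc]⟩

theorem IsPeriodic.shift {γ : BilliardTrajectory} (h : γ.IsPeriodic) (m : ℤ) :
    (γ.shift m).IsPeriodic := by
  obtain ⟨N, hN, hp⟩ := h
  refine ⟨N, hN, fun n => ?_⟩
  change γ.point _ = γ.point _
  rw [add_right_comm, hp]

theorem IsPeriodic.rotate {γ : BilliardTrajectory} (h : γ.IsPeriodic) (c : ZMod 5) :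
    (γ.rotate c).IsPeriodic := by
  obtain ⟨N, hN, hp⟩ := h
  refine ⟨N, hN, fun n => ?_⟩
  change _ * γ.point _ = _ * γ.point _
  rw [hp]

theorem unitDir_shift (m n : ℤ) : (γ.shift m).unitDir n = γ.unitDir (n + m) := by
  rw [unitDir, unitDir, add_right_comm]
  rfl

theorem unitDir_rotate (c : ZMod 5) (n : ℤ) :
    (γ.rotate c).unitDir n = vertex c * γ.unitDir n := by
  have h : (γ.rotate c).point (n + 1) - (γ.rotate c).point n =
      vertex c * (γ.point (n + 1) - γ.point n) := (mul_sub _ _ _).symm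
  rw [unitDir, unitDir, h, norm_mul, norm_vertex, one_mul, mul_smul_comm]

theorem point_add_mul {N : ℕ} (h : ∀ n, γ.point (n + N) = γ.point n) (j : ℕ) (n : ℤ) :
    γ.point (n + (N * j : ℕ)) = γ.point n := by
  have := apply_add_mul (s := γ.point) (q := N) (D := 0) (by simpa using h) j n
  simpa using this

variable {γ} {γ' : BilliardTrajectory}

theorem inner_unitDir (he : ∀ n, γ.edge n = γ'.edge n) (n : ℕ) :
    inner ℝ (γ.unitDir n) (γ'.unitDir n) = inner ℝ (γ.unitDir 0) (γ'.unitDir 0) := by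
  induction n with
  | zero => rfl
  | succ n ih =>
    push_cast
    rw [unitDir_succ, unitDir_succ, he, inner_edgeRefl, ih]

/-- Pair the direction of `γ` with the gap between the two bounce points. At a bounce the gap lies
along the common edge, so reflecting the direction leaves the pairing unchanged. Between bounces it
changes by the step of `γ` minus the step of `γ'` times the cosine of the constant angle. Over a
common period the changes sum to zero. -/
theorem sum_stepLength_eq (he : ∀ n, γ.edge n = γ'.edge n) {K : ℕ}
    (hK : ∀ n, γ.point (n + K) = γ.point n) (hK' : ∀ n, γ'.point (n + K) = γ'.point n) :
    ∑ n ∈ Finset.range K, γ.stepLength n =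
      (∑ n ∈ Finset.range K, γ'.stepLength n) *
        inner ℝ (γ.unitDir 0) (γ'.unitDir 0) := by
  have hstep : ∀ n : ℕ,
      (inner ℝ (γ.unitDir (n + 1 : ℕ)) (γ.point (n + 1 : ℕ) - γ'.point (n + 1 : ℕ)) : ℝ) -
        inner ℝ (γ.unitDir n) (γ.point n - γ'.point n) = γ.stepLength n -
        γ'.stepLength n * inner ℝ (γ.unitDir 0) (γ'.unitDir 0) := by
    intro n
    have h1 : γ.point (n + 1) - γ'.point (n + 1) = γ.point n - γ'.point n +
        ((γ.point (n + 1) - γ.point n) - (γ'.point (n + 1) - γ'.point n)) := by ring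
    push_cast
    rw [unitDir_succ, ← edgeRefl_sub_of_mem_side (γ.point_mem (n + 1))
      (by rw [he]; exact γ'.point_mem (n + 1)), inner_edgeRefl, h1, point_sub_eq γ, point_sub_eq γ',
      inner_add_right, inner_sub_right _ (_ • _), real_inner_smul_right, real_inner_smul_right,
      inner_unitDir he,
      real_inner_self_eq_norm_sq, norm_unitDir]
    ring
  have hsum := Finset.sum_range_sub
    (fun n : ℕ => (inner ℝ (γ.unitDir n) (γ.point n - γ'.point n) : ℝ)) K
  have h0 : γ.unitDir K = γ.unitDir 0 := by
    have h1 := hK 0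
    have h2 := hK 1
    rw [zero_add] at h1
    rw [add_comm] at h2
    rw [unitDir, unitDir, h1, h2, zero_add]
  have h3 := hK 0
  have h4 := hK' 0
  rw [zero_add] at h3 h4
  rw [Finset.sum_congr rfl fun n _ => hstep n, Finset.sum_sub_distrib, ← Finset.sum_mul, h0, h3, h4,
    Nat.cast_zero, sub_self] at hsum
  linarith

theorem unitDir_zero_eq (hp : γ.IsPeriodic) (hp' : γ'.IsPeriodic)
    (he : ∀ n, γ.edge n = γ'.edge n) : γ.unitDir 0 = γ'.unitDir 0 := by
  obtain ⟨N, hN, h⟩ := hp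
  obtain ⟨N', hN', h'⟩ := hp'
  have hK := γ.point_add_mul h N'
  have hK' := γ'.point_add_mul h' N
  rw [mul_comm N'] at hK'
  have h1 := sum_stepLength_eq he hK hK'
  have h2 := sum_stepLength_eq (fun n => (he n).symm) hK' hK
  have hne : (Finset.range (N * N')).Nonempty := by
    rw [Finset.nonempty_range_iff]
    positivity
  have h3 := Finset.sum_pos (fun (n : ℕ) _ => γ.stepLength_pos n) hne
  have h4 := Finset.sum_pos (fun (n : ℕ) _ => γ'.stepLength_pos n) hne
  rw [real_inner_comm] at h2
  rw [← inner_eq_one_iff_of_norm_eq_one (𝕜 := ℝ) (γ.norm_unitDir 0) (γ'.norm_unitDir 0)]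
  set ρ : ℝ := inner ℝ (γ.unitDir 0) (γ'.unitDir 0)
  -- For total lengths `L` and `L'` over a common period, `L = L' * ρ` and `L' = L * ρ`. Positivity
  -- of both forces `ρ = 1`.
  have h5 : 0 < ρ := by
    by_contra! hle
    nlinarith
  rw [h2] at h1
  have h6 : ρ * ρ = 1 := by
    apply mul_left_cancel₀ h3.ne'
    linarith
  nlinarith

/-- Periodic trajectories with the same edges have the same direction. -/
theorem unitDir_eq (hp : γ.IsPeriodic) (hp' : γ'.IsPeriodic)
    (he : ∀ n, γ.edge n = γ'.edge n) (n : ℤ) : γ.unitDir n = γ'.unitDir n := by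
  have := unitDir_zero_eq (hp.shift n) (hp'.shift n) fun k => he (k + n)
  rwa [unitDir_shift, unitDir_shift, zero_add] at this

/-- The shifted and the rotated trajectory are both periodic and hit the same edges. -/
theorem unitDir_add_of_edge_add (hp : γ.IsPeriodic) {q : ℤ} {D : ZMod 5}
    (h : ∀ n, γ.edge (n + q) = γ.edge n + D) (n : ℤ) :
    γ.unitDir (n + q) = vertex D * γ.unitDir n := by
  rw [← unitDir_shift, ← unitDir_rotate]
  exact unitDir_eq (hp.shift q) (hp.rotate D) h n

/-- The line along which the trajectory leaves a bounce meets the boundary again only on a different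
edge. -/
theorem eq_point_of_mem_side {n : ℤ} {c : ℝ} {z : ℂ} (hz : z ∈ side (γ.edge n))
    (h : z = γ.point n + c • γ.unitDir n) : z = γ.point n := by
  have h1 : z = γ.point n + (c * ‖γ.point (n + 1) - γ.point n‖⁻¹) •
      (γ.point (n + 1) - γ.point n) := by
    rw [h, mul_smul, unitDir]
  rcases eq_or_eq_of_mem_line (γ.point_mem n) (γ.point_mem (n + 1)) (γ.edge_ne n).symm hz h1 with
    h2 | h2
  · exact h2
  · exact absurd (eq_of_mem_side (γ.point_mem (n + 1)) (h2 ▸ hz)) (γ.edge_ne n)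

/-- An even period of the sequence of edges is a period of the trajectory. -/
theorem point_add_of_edge_add (hp : γ.IsPeriodic) {M : ℕ} (hM : Even M)
    (h : ∀ n, γ.edge (n + M) = γ.edge n) (n : ℤ) : γ.point (n + M) = γ.point n := by
  have hv : ∀ n, γ.unitDir (n + M) = γ.unitDir n := fun n => by
    rw [unitDir_add_of_edge_add hp (D := 0) (by simpa using h), vertex_zero, one_mul]
  -- The displacement over `M` bounces, measured transversally to the direction of travel. It
  -- changes sign at each bounce, hence is `M`-periodic for even `M`.
  set a : ℤ → ℝ := fun n => (conj (γ.unitDir n) * (γ.point (n + M) - γ.point n)).im with ha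
  have hstep : ∀ n, a (n + 1) = -a n := by
    intro n
    have h1 : γ.point (n + 1 + M) - γ.point (n + 1) = γ.point (n + M) - γ.point n +
        ((γ.point (n + M + 1) - γ.point (n + M)) - (γ.point (n + 1) - γ.point n)) := by
      rw [add_right_comm]
      ring
    have h2 : ∀ r : ℝ, (conj (γ.unitDir n) * (r • γ.unitDir n)).im = 0 := fun r => by
      rw [mul_smul_comm, Complex.conj_mul', Complex.smul_im, ← Complex.ofReal_pow,
        Complex.ofReal_im, smul_zero]
    simp only [ha]
    rw [unitDir_succ, ← edgeRefl_sub_of_mem_side (γ.point_mem (n + 1 + M))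
      (by rw [h]; exact γ.point_mem (n + 1)), h, im_conj_mul_edgeRefl, h1, point_sub_eq γ,
      point_sub_eq γ, hv, ← sub_smul, mul_add, Complex.add_im, h2, add_zero]
  have haM : ∀ n, a (n + M) = a n := by
    obtain ⟨j, rfl⟩ := hM
    have h2 : ∀ n, a (n + 2) = a n := fun n => by
      rw [show n + 2 = n + 1 + 1 by ring, hstep, hstep, neg_neg]
    intro n
    have := apply_add_mul (s := a) (q := 2) (D := 0) (by simpa using h2) j n
    rwa [smul_zero, add_zero, two_mul] at this
  obtain ⟨N, hN, hx⟩ := hp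
  -- Transverse displacements over successive blocks of `M` bounces add up, whereas after `M * N`
  -- bounces the trajectory has returned. So `N * a n = 0`.
  have hlin : ∀ j : ℕ,
      (conj (γ.unitDir n) * (γ.point (n + (M * j : ℕ)) - γ.point n)).im = j * a n := by
    intro j
    induction j with
    | zero => simp
    | succ j ih =>
      have h1 : a (n + (M * j : ℕ)) = a n := by
        have := apply_add_mul (s := a) (q := M) (D := 0) (by simpa using haM) j n
        rwa [smul_zero, add_zero] at this
      have h2 : γ.unitDir (n + (M * j : ℕ)) = γ.unitDir n := by
        have := apply_add_mul (s := γ.unitDir) (q := M) (D := 0) (by simpa using hv) j n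
        rwa [smul_zero, add_zero] at this
      have h3 : n + (M * (j + 1) : ℕ) = n + (M * j : ℕ) + M := by
        push_cast
        ring
      simp only [ha] at h1 ih ⊢
      rw [h2] at h1
      rw [h3, ← sub_add_sub_cancel _ (γ.point (n + (M * j : ℕ))), mul_add, Complex.add_im, h1, ih]
      push_cast
      ring
  have h0 := hlin N
  rw [mul_comm M, γ.point_add_mul hx, sub_self, mul_zero, Complex.zero_im] at h0
  have ha0 : a n = 0 := by
    rcases mul_eq_zero.1 h0.symm with h1 | h1
    · exact absurd h1 (by positivity)
    · exact h1
  refine eq_point_of_mem_side (c := (conj (γ.unitDir n) * (γ.point (n + M) - γ.point n)).re)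
    (by rw [← h]; exact γ.point_mem _) ?_
  have h5 : conj (γ.unitDir n) * (γ.point (n + M) - γ.point n) =
      ((conj (γ.unitDir n) * (γ.point (n + M) - γ.point n)).re : ℂ) :=
    Complex.ext rfl (by rw [Complex.ofReal_im]; exact ha0)
  have h6 : γ.unitDir n * conj (γ.unitDir n) = 1 := by
    rw [Complex.mul_conj', norm_unitDir]
    norm_num
  rw [Complex.real_smul, ← h5]
  linear_combination (γ.point n - γ.point (n + M)) * h6

end BilliardTrajectory

/-- Makes `ZMod 5` a field, so that a nonzero increment can be cancelled. -/
instance fact_prime_five : Fact (Nat.Prime 5) := ⟨by norm_num⟩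

theorem sideVec_sq (k : ZMod 5) : sideVec k ^ 2 = -vertex (2 * k + 1) * (‖sideVec k‖ : ℂ) ^ 2 := by
  rw [← Complex.mul_conj', conj_sideVec]
  linear_combination (-sideVec k ^ 2) * vertex_mul_vertex_neg (2 * k + 1)

theorem edgeRefl_sideMid (k : ZMod 5) : edgeRefl k (sideMid k) = -sideMid k := by
  rw [edgeRefl, neg_mul, neg_inj]
  rw [sideMid_eq, show 2 * k + 1 = k + k + 1 by ring, vertex_add (k + k), vertex_add k]
  simp only [map_mul, map_div₀, map_add, map_one, conj_vertex, Complex.conj_ofNat]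
  linear_combination vertex k * (1 + vertex 1) / 2 * vertex_mul_vertex_neg k +
    vertex k * vertex k * vertex (-k) / 2 * vertex_mul_vertex_neg 1

theorem apply_add_even_of_alternating {A : Type*} [AddCommGroup A] {σ : ℤ → A}
    (h : ∀ n, σ (n + 1) = -σ n) (n : ℤ) (j : ℕ) : σ (n + (2 * j : ℕ)) = σ n := by
  have h2 : ∀ n, σ (n + (2 : ℕ)) = σ n + 0 := fun n => by
    rw [show n + (2 : ℕ) = n + 1 + 1 by push_cast; ring, h, h, neg_neg, add_zero]
  rw [apply_add_mul h2, smul_zero, add_zero]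

namespace BilliardTrajectory

variable {γ : BilliardTrajectory}

/-! ### Trajectories that are parallel to an edge -/

theorem isParallelToEdge_iff :
    γ.IsParallelToEdge ↔ ∃ (n : ℤ) (k : ZMod 5) (c : ℝ), γ.unitDir n = c • sideVec k := by
  constructor
  · rintro ⟨n, k, c, h⟩
    exact ⟨n, k, ‖γ.point (n + 1) - γ.point n‖⁻¹ * c, by rw [unitDir, h, smul_smul]⟩
  · rintro ⟨n, k, c, h⟩
    exact ⟨n, k, γ.stepLength n * c, by rw [point_sub_eq, h, smul_smul]⟩

/-- The square of `sideVec k` is a positive multiple of `-vertex (2 * k + 1)`, and `2 * k + 1` takes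
every value modulo 5. -/
theorem isParallelToEdge_of_sq_eq {n : ℤ} {b : ZMod 5} (h : γ.unitDir n ^ 2 = -vertex b) :
    γ.IsParallelToEdge := by
  rw [isParallelToEdge_iff]
  -- The factor `3` is the inverse of `2` modulo 5.
  obtain ⟨k, rfl⟩ : ∃ k : ZMod 5, 2 * k + 1 = b := ⟨3 * (b - 1), by
    linear_combination (b - 1) * (by decide : (5 : ZMod 5) = 0)⟩
  have h0 : (‖sideVec k‖ : ℂ) ≠ 0 := by
    rw [Complex.ofReal_ne_zero, norm_ne_zero_iff]
    exact sideVec_ne_zero k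
  have h1 : ((‖sideVec k‖ : ℂ) * γ.unitDir n) ^ 2 = sideVec k ^ 2 := by
    rw [sideVec_sq, mul_pow, h]
    ring
  rcases sq_eq_sq_iff_eq_or_eq_neg.1 h1 with h2 | h2
  · refine ⟨n, k, ‖sideVec k‖⁻¹, ?_⟩
    rw [Complex.real_smul, ← mul_right_inj' h0, h2, Complex.ofReal_inv, mul_inv_cancel_left₀ h0]
  · refine ⟨n, k, -‖sideVec k‖⁻¹, ?_⟩
    rw [neg_smul, Complex.real_smul, ← mul_right_inj' h0, h2, Complex.ofReal_inv, mul_neg,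
      mul_inv_cancel_left₀ h0]

theorem unitDir_succ_of_eq_smul {n : ℤ} {k : ZMod 5} {c : ℝ} (h : γ.unitDir n = c • sideVec k) :
    γ.unitDir (n + 1) = c • sideVec (2 * γ.edge (n + 1) - k) := by
  rw [unitDir_succ, h, edgeRefl_smul, edgeRefl_sideVec']

theorem IsParallelToEdge.forall (h : γ.IsParallelToEdge) (n : ℤ) :
    ∃ (k : ZMod 5) (c : ℝ), γ.unitDir n = c • sideVec k := by
  obtain ⟨m, hm⟩ := isParallelToEdge_iff.1 h
  refine forall_int_of_iff_succ (P := fun n => ∃ (k : ZMod 5) (c : ℝ), γ.unitDir n = c • sideVec k)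
    (fun n => ⟨?_, ?_⟩) hm n
  · rintro ⟨k, c, h⟩
    exact ⟨_, c, unitDir_succ_of_eq_smul h⟩
  · rintro ⟨k, c, h⟩
    refine ⟨2 * γ.edge (n + 1) - k, c, ?_⟩
    rw [← edgeRefl_sideVec', ← edgeRefl_smul, ← h, unitDir_succ, edgeRefl_edgeRefl]

/-- A chord that is parallel to the edge `k` is symmetric under the reflection of the pentagon
which preserves this edge. -/
theorem point_succ_of_eq_smul {n : ℤ} {k : ZMod 5} {c : ℝ} (h : γ.unitDir n = c • sideVec k) :
    γ.point (n + 1) = vertex (2 * k + 1) * conj (γ.point n) ∧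
      γ.edge (n + 1) = 2 * k - γ.edge n := by
  have hmem := conj_mem_side (2 * k) (γ.point_mem n)
  have hc : c ≠ 0 := by
    rintro rfl
    exact γ.unitDir_ne_zero n (by rw [h, zero_smul])
  have hfix : edgeRefl k (vertex (2 * k + 1) * conj (γ.point n) - γ.point n) =
      vertex (2 * k + 1) * conj (γ.point n) - γ.point n := by
    have h1 : vertex (2 * k + 1) * conj (γ.point n) = -edgeRefl k (γ.point n) := by
      rw [edgeRefl]
      ring
    rw [h1, edgeRefl_sub, edgeRefl_neg, edgeRefl_edgeRefl]
    ring
  obtain ⟨b, hb⟩ := exists_smul_sideVec_of_edgeRefl_eq hfix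
  have hne := γ.edge_ne n
  have hline : vertex (2 * k + 1) * conj (γ.point n) =
      γ.point n + (b * (c⁻¹ * (γ.stepLength n)⁻¹)) • (γ.point (n + 1) - γ.point n) := by
    rw [point_sub_eq, h, smul_smul, smul_smul]
    have h1 : b * (c⁻¹ * (γ.stepLength n)⁻¹) * γ.stepLength n * c = b := by
      have := (γ.stepLength_pos n).ne'
      field_simp
    rw [h1, ← hb]
    ring
  rcases eq_or_eq_of_mem_line (γ.point_mem n) (γ.point_mem (n + 1)) hne.symm hmem hline with h1 | h1
  -- If the mirror image of the point were the point itself, its edge would be `k`, and a chord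
  -- parallel to `k` would never leave that edge.
  · exfalso
    rw [h1] at hmem
    have h2 := eq_of_mem_side hmem (γ.point_mem n)
    have h3 : k = γ.edge n := by
      linear_combination 3 * h2 + (γ.edge n - k) * (by decide : (5 : ZMod 5) = 0)
    have h4 := congrArg (height k) (γ.point_sub_eq n)
    rw [h, map_smul, map_smul, height_sideVec, smul_zero, smul_zero, map_sub, sub_eq_zero] at h4
    rw [h3, height_of_mem_side (γ.point_mem n)] at h4
    exact hne (eq_of_height_eq (γ.point_mem _) h4)
  · rw [h1] at hmem
    exact ⟨h1.symm, eq_of_mem_side (γ.point_mem _) hmem⟩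

theorem IsParallelToEdge.point_succ (h : γ.IsParallelToEdge) (n : ℤ) :
    γ.point (n + 1) = vertex (γ.edge (n + 1) + γ.edge n + 1) * conj (γ.point n) := by
  obtain ⟨k, c, hk⟩ := h.forall n
  obtain ⟨h1, h2⟩ := point_succ_of_eq_smul hk
  rw [h1, h2, sub_add_cancel]

/-- A chord parallel to `k` joins edges with sum `2 * k`, and the next chord is parallel to `2 *
γ.edge (n + 1) - k`; eliminating `k` leaves equal increments. -/
theorem IsParallelToEdge.exists_edge_succ (h : γ.IsParallelToEdge) :
    ∃ δ : ZMod 5, δ ≠ 0 ∧ ∀ n, γ.edge (n + 1) = γ.edge n + δ := by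
  have hstep : ∀ n, γ.edge (n + 1 + 1) - γ.edge (n + 1) = γ.edge (n + 1) - γ.edge n := by
    intro n
    obtain ⟨k, c, hk⟩ := h.forall n
    have h1 := (point_succ_of_eq_smul hk).2
    have h2 := (point_succ_of_eq_smul (unitDir_succ_of_eq_smul hk)).2
    linear_combination h2 + h1
  refine ⟨γ.edge (0 + 1) - γ.edge 0, sub_ne_zero.2 (γ.edge_ne 0), fun n => ?_⟩
  have := forall_int_of_iff_succ
    (P := fun n => γ.edge (n + 1) - γ.edge n = γ.edge (0 + 1) - γ.edge 0)
    (fun n => by rw [hstep]) (m := 0) rfl n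
  rw [← this, add_sub_cancel]

/-- Two bounces rotate the point by `vertex (2 * δ)` and a single one reflects it. After five, the
rotations combine to a multiple `5 * δ = 0`, leaving the reflection in the axis of the edge. -/
theorem IsParallelToEdge.point_add_five (h : γ.IsParallelToEdge) (n : ℤ) :
    γ.point (n + 5) = vertex (2 * γ.edge n + 1) * conj (γ.point n) := by
  obtain ⟨δ, -, hδ⟩ := h.exists_edge_succ
  have h2 : ∀ n, γ.point (n + 1 + 1) = vertex (2 * δ) * γ.point n := by
    intro n
    rw [h.point_succ, h.point_succ n, map_mul, conj_vertex, Complex.conj_conj, ← mul_assoc,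
      ← vertex_add, hδ (n + 1), hδ n]
    congr 2
    ring
  rw [show n + 5 = n + 1 + 1 + 1 + 1 + 1 by ring, h2, h2, h.point_succ, ← mul_assoc, ← mul_assoc,
    ← vertex_add, ← vertex_add, hδ]
  congr 2
  linear_combination δ * (by decide : (5 : ZMod 5) = 0)

theorem conj_fixed_iff {k : ZMod 5} {z : ℂ} (hz : z ∈ side k) :
    vertex (2 * k + 1) * conj z = z ↔ z = sideMid k := by
  obtain ⟨c, hc⟩ := sub_eq_smul_sideVec hz (sideMid_mem_side k)
  have hz : z = sideMid k + c • sideVec k := by rw [← hc, add_sub_cancel]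
  have h1 : vertex (2 * k + 1) * conj (sideMid k) = sideMid k := by
    rw [← neg_inj, ← edgeRefl_sideMid, edgeRefl, neg_mul]
  have h2 : vertex (2 * k + 1) * conj (c • sideVec k) = -(c • sideVec k) := by
    have := edgeRefl_sideVec k
    rw [edgeRefl] at this
    rw [Complex.real_smul, map_mul, Complex.conj_ofReal]
    linear_combination (-c : ℂ) * this
  rw [hz, map_add, mul_add, h1, h2, add_right_inj, add_eq_left, neg_eq_self]

theorem IsParallelToEdge.point_add_five_eq_iff (h : γ.IsParallelToEdge) (n : ℤ) :
    γ.point (n + 5) = γ.point n ↔ γ.point n = sideMid (γ.edge n) := by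
  rw [h.point_add_five, conj_fixed_iff (γ.point_mem n)]

theorem IsParallelToEdge.edge_add (h : γ.IsParallelToEdge) (k : ℕ) :
    (∀ n, γ.edge (n + k) = γ.edge n) ↔ 5 ∣ k := by
  obtain ⟨δ, hδ0, hδ⟩ := h.exists_edge_succ
  have h1 := apply_add_mul (s := γ.edge) (q := 1) (D := δ) (by simpa using hδ) k
  rw [one_mul] at h1
  simp only [h1, add_eq_left, forall_const, nsmul_eq_mul, mul_eq_zero, hδ0, or_false,
    ZMod.natCast_eq_zero_iff]

theorem IsParallelToEdge.sequenceLength_eq (h : γ.IsParallelToEdge) : γ.sequenceLength = 5 :=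
  seqPeriod_eq h.edge_add

theorem IsParallelToEdge.point_add_ten (h : γ.IsParallelToEdge) (n : ℤ) :
    γ.point (n + 10) = γ.point n := by
  have h5 : γ.edge (n + 5) = γ.edge n := (h.edge_add 5).2 dvd_rfl n
  rw [show n + 10 = n + 5 + 5 by ring, h.point_add_five, h.point_add_five, h5, map_mul,
    conj_vertex, Complex.conj_conj, ← mul_assoc, vertex_mul_vertex_neg, one_mul]

theorem edge_add_of_point_add {k : ℤ} (h : ∀ n, γ.point (n + k) = γ.point n) (n : ℤ) :
    γ.edge (n + k) = γ.edge n :=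
  edge_eq_of_point_eq (h n)

theorem IsParallelToEdge.five_dvd_combLength (h : γ.IsParallelToEdge) : 5 ∣ γ.combLength :=
  (h.edge_add _).1 (edge_add_of_point_add ((seqPeriod_dvd_iff γ.point _).1 dvd_rfl))

theorem IsParallelToEdge.combLength_of_hitsMidpoint (h : γ.IsParallelToEdge)
    (hm : γ.HitsMidpoint) : γ.combLength = 5 := by
  refine Nat.dvd_antisymm ((seqPeriod_dvd_iff _ _).2 ?_) h.five_dvd_combLength
  obtain ⟨m, hm⟩ := hm
  rw [← h.point_add_five_eq_iff] at hm
  -- One midpoint suffices: the step from `n` to `n + 1` is injective and depends only on the edges,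
  -- which are 5-periodic.
  refine forall_int_of_iff_succ (P := fun n => γ.point (n + (5 : ℕ)) = γ.point n) (fun n => ?_) hm
  have h5 := (h.edge_add 5).2 dvd_rfl
  rw [add_right_comm n 1, h.point_succ, h.point_succ, add_right_comm n _ 1, h5, h5,
    mul_right_inj' (vertex_ne_zero _), (starRingEnd ℂ).injective.eq_iff]

theorem IsParallelToEdge.combLength_of_not_hitsMidpoint (h : γ.IsParallelToEdge)
    (hm : ¬γ.HitsMidpoint) : γ.combLength = 10 := by
  have h10 : γ.combLength ∣ 10 := (seqPeriod_dvd_iff _ _).2 h.point_add_ten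
  have h5 := h.five_dvd_combLength
  have hne : γ.combLength ≠ 5 := fun h0 => hm
    ⟨0, (h.point_add_five_eq_iff 0).1 ((seqPeriod_dvd_iff γ.point 5).1 h0.dvd 0)⟩
  have hle := Nat.le_of_dvd (by norm_num) h10
  obtain ⟨t, ht⟩ := h5
  have : t ≤ 2 := by omega
  interval_cases t
  · rw [ht] at h10
    omega
  · exact absurd ht hne
  · exact ht

/-- The constant edge increment `δ ≠ 0` becomes `±δ` with alternating signs, so the labels alternate
between two values. -/
theorem IsParallelToEdge.seqPeriod_unfolded (h : γ.IsParallelToEdge) {f σ : ℤ → ZMod 5}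
    (hσ : ∀ n, σ n * σ n = 1) (hσ' : ∀ n, σ (n + 1) = -σ n)
    (hf : ∀ n, γ.edge (n + 1) - γ.edge n = σ n * (f (n + 1) - f n)) : seqPeriod f = 2 := by
  obtain ⟨δ, hδ0, hδ⟩ := h.exists_edge_succ
  have h1 : ∀ n, f (n + 1) = f n + σ n * δ := fun n => by
    linear_combination σ n * (hδ n) - σ n * (hf n) - (f (n + 1) - f n) * hσ n
  have h2 : ∀ n, f (n + (2 : ℕ)) = f n + 0 := fun n => by
    rw [show n + (2 : ℕ) = n + 1 + 1 by push_cast; ring, h1, h1, hσ']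
    ring
  have h3 := apply_add_mul h2
  refine seqPeriod_eq fun k => ⟨fun hk => ?_, ?_⟩
  · by_contra hodd
    rw [← even_iff_two_dvd, Nat.not_even_iff_odd] at hodd
    obtain ⟨j, rfl⟩ := hodd
    have h4 := hk 0
    rw [show 0 + ((2 * j + 1 : ℕ) : ℤ) = 0 + 1 + (2 * j : ℕ) by push_cast; ring, h3, h1,
      smul_zero, add_zero, add_eq_left] at h4
    have h6 := hσ 0
    have h7 : δ = 0 := by linear_combination σ 0 * h4 - δ * h6
    exact hδ0 h7
  · rintro ⟨j, rfl⟩ n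
    rw [h3, smul_zero, add_zero]

/-! ### Trajectories that are not parallel to an edge -/

/-- The shift may be negative; adding a multiple of the period makes it a natural number. -/
theorem IsPeriodic.exists_nat_edge_add (hp : γ.IsPeriodic) {m : ℤ}
    (hm : ∀ n, γ.edge (n + m) = γ.edge n + 1) :
    ∃ k : ℕ, ∀ n, γ.edge (n + k) = γ.edge n + 1 := by
  obtain ⟨N, hN, h⟩ := hp
  have h1 : 0 ≤ m + (N * m.natAbs : ℕ) := by
    have : m.natAbs ≤ N * m.natAbs := Nat.le_mul_of_pos_left _ hN
    omega
  refine ⟨(m + (N * m.natAbs : ℕ)).toNat, fun n => ?_⟩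
  rw [Int.toNat_of_nonneg h1, ← add_assoc, edge_eq_of_point_eq (γ.point_add_mul h _ _), hm]

theorem edge_add_of_diff_add {k : ℤ}
    (h : ∀ n, γ.edge (n + k + 1) - γ.edge (n + k) = γ.edge (n + 1) - γ.edge n) (n : ℤ) :
    γ.edge (n + k) = γ.edge n + (γ.edge k - γ.edge 0) := by
  refine forall_int_of_iff_succ (P := fun n => γ.edge (n + k) = γ.edge n + (γ.edge k - γ.edge 0))
    (fun n => ?_) (m := 0) (by rw [zero_add, add_sub_cancel]) n
  have h1 := h n
  rw [add_right_comm n 1 k]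
  constructor <;> intro h2
  · linear_combination h2 + h1
  · linear_combination h2 - h1

/-- An odd number of bounces sends the direction `u` to `-vertex a * conj u`. Equating this with
`vertex D * u` gives `u ^ 2 = -vertex (a - D)`, so `u` is parallel to an edge. -/
theorem even_of_edge_add (hp : γ.IsPeriodic) (hn : ¬γ.IsParallelToEdge) {q : ℕ} {D : ZMod 5}
    (h : ∀ n, γ.edge (n + q) = γ.edge n + D) : Even q := by
  by_contra hodd
  rw [Nat.not_even_iff_odd] at hodd
  obtain ⟨j, rfl⟩ := hodd
  obtain ⟨a, ha⟩ := γ.unitDir_add_odd 0 j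
  rw [unitDir_add_of_edge_add hp h] at ha
  refine hn (isParallelToEdge_of_sq_eq (n := 0) (b := a - D) ?_)
  have h1 : γ.unitDir 0 * conj (γ.unitDir 0) = 1 := by
    rw [Complex.mul_conj', norm_unitDir]
    norm_num
  rw [vertex_sub]
  linear_combination vertex (-D) * γ.unitDir 0 * ha - vertex (-D) * vertex a * h1 -
    γ.unitDir 0 ^ 2 * vertex_mul_vertex_neg D

/-- The direction after an even number of bounces, in terms of the unfolded sequence of labels. -/
theorem unitDir_add_even_eq {f σ : ℤ → ZMod 5} (hσ' : ∀ n, σ (n + 1) = -σ n)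
    (hf : ∀ n, γ.edge (n + 1) - γ.edge n = σ n * (f (n + 1) - f n)) (n : ℤ) (j : ℕ) :
    γ.unitDir (n + (2 * j : ℕ)) = vertex (γ.edge (n + (2 * j : ℕ)) - γ.edge n -
      σ n * (f (n + (2 * j : ℕ)) - f n)) * γ.unitDir n := by
  have hσj := apply_add_even_of_alternating hσ' n
  induction j with
  | zero => simp [vertex_zero]
  | succ j ih =>
    have h3 : n + (2 * (j + 1) : ℕ) = n + (2 * j : ℕ) + 2 := by
      push_cast
      ring
    have h4 := hf (n + (2 * j : ℕ))
    have h5 := hf (n + (2 * j : ℕ) + 1)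
    rw [hσ', add_assoc _ 1 1, show (1 + 1 : ℤ) = 2 by norm_num] at h5
    rw [hσj] at h4 h5
    rw [h3, unitDir_add_two, ih, ← mul_assoc, ← vertex_add]
    congr 2
    -- The two signs are opposite, so the edge change minus the signed label change is twice the
    -- second edge increment, as in `unitDir_add_two`.
    linear_combination h5 - h4

theorem lengths_of_not_isParallelToEdge (hp : γ.IsPeriodic) (hn : ¬γ.IsParallelToEdge) {m : ℤ}
    (hm : ∀ n, γ.edge (n + m) = γ.edge n + 1) {f σ : ℤ → ZMod 5}
    (hσ : ∀ n, σ n * σ n = 1) (hσ' : ∀ n, σ (n + 1) = -σ n)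
    (hf : ∀ n, γ.edge (n + 1) - γ.edge n = σ n * (f (n + 1) - f n)) :
    γ.combLength = 5 * seqPeriod f ∧ γ.sequenceLength = 5 * seqPeriod f := by
  obtain ⟨k', hk⟩ := hp.exists_nat_edge_add hm
  set p := seqPeriod fun n => γ.edge (n + 1) - γ.edge n
  have hpd : ∀ k : ℕ, p ∣ k ↔
      ∀ n, γ.edge (n + k + 1) - γ.edge (n + k) = γ.edge (n + 1) - γ.edge n :=
    seqPeriod_dvd_iff _
  set D := γ.edge p - γ.edge 0
  have hD : ∀ n, γ.edge (n + p) = γ.edge n + D :=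
    edge_add_of_diff_add ((hpd p).1 dvd_rfl)
  have hDj := apply_add_mul hD
  have hdvd : ∀ {k : ℕ} {E : ZMod 5}, (∀ n, γ.edge (n + k) = γ.edge n + E) → p ∣ k := by
    intro k E h
    refine (hpd k).2 fun n => ?_
    have h1 := h (n + 1)
    rw [add_right_comm] at h1
    linear_combination h1 - h n
  -- The shift that adds `1` is a multiple of `p`, so `D = 0` is impossible; this also rules out the
  -- default value `p = 0`.
  have hD0 : D ≠ 0 := by
    intro h0
    obtain ⟨t, rfl⟩ := hdvd hk
    have h1 := hk 0
    rw [hDj, h0, smul_zero, add_right_inj] at h1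
    exact absurd h1 (by decide)
  have hM : γ.sequenceLength = 5 * p := by
    refine seqPeriod_eq fun k => ⟨fun h => ?_, ?_⟩
    · obtain ⟨t, rfl⟩ := hdvd (E := 0) (by simpa using h)
      have h1 := h 0
      rw [hDj, add_eq_left, nsmul_eq_mul, mul_eq_zero, or_iff_left hD0,
        ZMod.natCast_eq_zero_iff] at h1
      obtain ⟨s, rfl⟩ := h1
      exact ⟨s, by ring⟩
    · rintro ⟨s, rfl⟩ n
      rw [show 5 * p * s = p * (5 * s) by ring, hDj, nsmul_eq_mul, Nat.cast_mul,
        show ((5 : ℕ) : ZMod 5) = 0 by decide, zero_mul, zero_mul, add_zero]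
  have hpe : Even p := even_of_edge_add hp hn hD
  have hl : seqPeriod f = p := by
    refine seqPeriod_eq fun k => ⟨fun h => ?_, ?_⟩
    · have hfk : ∀ n, γ.edge (n + k + 1) - γ.edge (n + k) = σ (n + k) * (f (n + 1) - f n) := by
        intro n
        rw [hf, h, add_right_comm, h]
      rcases Nat.even_or_odd' k with ⟨j, rfl | rfl⟩
      · refine (hpd _).2 fun n => ?_
        rw [hfk, apply_add_even_of_alternating hσ', hf]
      -- An odd label period would reverse the edge increments, making `γ.edge (n + k) + γ.edge n`
      -- constant. The symmetry shift `k'` adds `2` to this sum.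
      · exfalso
        set k := 2 * j + 1
        have hσk : ∀ n, σ (n + k) = -σ n := fun n => by
          rw [← hσ', ← apply_add_even_of_alternating hσ' (n + 1) j]
          congr 1
          push_cast [k]
          ring
        have hC : ∀ n, γ.edge (n + k) + γ.edge n = γ.edge (0 + k) + γ.edge 0 := by
          refine forall_int_of_iff_succ (fun n => ?_) (m := 0) rfl
          have h1 := hfk n
          have h2 := hf n
          rw [hσk] at h1
          rw [add_right_comm n 1]
          constructor <;> intro h3
          · linear_combination h3 + h1 + h2
          · linear_combination h3 - h1 - h2
        have h1 := hC (0 + k')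
        rw [add_right_comm, hk, hk] at h1
        have h2 : (2 : ZMod 5) = 0 := by linear_combination h1
        exact absurd h2 (by decide)
    -- Over `p` bounces the direction turns by `vertex D`, and also by `vertex` of `D` minus the
    -- signed label change. So the label change is zero.
    · have hper : ∀ n, f (n + p) = f n + 0 := by
        intro n
        obtain ⟨j, hj⟩ := hpe
        rw [← two_mul] at hj
        have h1 := unitDir_add_even_eq hσ' hf n j
        rw [← hj, unitDir_add_of_edge_add hp hD] at h1
        have h2 := vertex_injective (mul_right_cancel₀ (γ.unitDir_ne_zero n) h1)
        rw [hD] at h2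
        linear_combination σ n * h2 - (f (n + p) - f n) * hσ n
      rintro ⟨j, rfl⟩ n
      rw [apply_add_mul hper, smul_zero, add_zero]
  rw [hl]
  refine ⟨?_, hM⟩
  rw [← hM]
  refine Nat.dvd_antisymm ((seqPeriod_dvd_iff _ _).2 ?_) ((seqPeriod_dvd_iff _ _).2 ?_)
  · exact point_add_of_edge_add hp (by rw [hM]; exact hpe.mul_left 5)
      ((seqPeriod_dvd_iff _ _).1 dvd_rfl)
  · exact edge_add_of_point_add ((seqPeriod_dvd_iff _ _).1 dvd_rfl)

end BilliardTrajectory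

/-! ### Folding a trajectory on the double pentagon -/

theorem int_units_cast_mul_self {R : Type*} [Ring R] (s : ℤˣ) :
    ((s : ℤ) : R) * ((s : ℤ) : R) = 1 := by
  rcases Int.units_eq_one_or s with rfl | rfl <;> simp

/-- Subtracting `2 * sideMid k` carries the edge to the opposite side of the origin, and the linear
reflection brings it back pointwise. This is why folds that differ by `edgeRefl k` agree across the
gluing. -/
theorem edgeRefl_sub_two_sideMid {k : ZMod 5} {z : ℂ} (hz : z ∈ side k) :
    edgeRefl k (z - 2 * sideMid k) = z := by
  have h1 := edgeRefl_sub_of_mem_side hz (sideMid_mem_side k)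
  rw [show z - 2 * sideMid k = z - sideMid k - sideMid k by ring, edgeRefl_sub, h1,
    edgeRefl_sideMid]
  ring

theorem exists_eq_vertex_of_mem_halfPentagon {z : ℂ} (hz : z ∈ halfPentagon 1) (hn : ‖z‖ = 1) :
    ∃ k, z = vertex k := by
  by_contra! hne
  have hlt : ∀ k, inner ℝ z (vertex k) < 1 := by
    intro k
    have h1 := real_inner_le_norm z (vertex k)
    rw [hn, norm_vertex, one_mul] at h1
    exact lt_of_le_of_ne h1 fun h2 =>
      hne k ((inner_eq_one_iff_of_norm_eq_one (𝕜 := ℝ) hn (norm_vertex k)).1 h2)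
  -- A unit vector other than the vertices has inner product less than 1 with each of them, hence
  -- with the whole hull, but not with itself.
  have hsub : halfPentagon 1 ⊆ {w | innerₛₗ ℝ z w < 1} := by
    refine convexHull_min ?_ (convex_halfSpace_lt (LinearMap.isLinear _) 1)
    rintro _ ⟨k, rfl⟩
    simpa using hlt k
  have h3 := hsub hz
  simp only [Set.mem_ofPred_eq, innerₛₗ_apply_apply, real_inner_self_eq_norm_sq, hn] at h3
  norm_num at h3

theorem mem_halfPentagon (s : ℤˣ) (k : ZMod 5) : ((s : ℤ) : ℂ) * vertex k ∈ halfPentagon s :=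
  subset_convexHull _ _ ⟨k, rfl⟩

/-- The isometries which lay a half of the double pentagon onto the table. The sign `σ` is the one
with which the isometry acts on the numbers of the edges. -/
theorem fold_eq {F : ℂ ≃ₗᵢ[ℝ] ℂ} {s : ℤˣ} (hF : F '' halfPentagon s = halfPentagon 1) :
    ∃ σ c : ZMod 5, σ = 1 ∧ (∀ z, F z = ((s : ℤ) : ℂ) * vertex c * z) ∨
      σ = -1 ∧ ∀ z, F z = ((s : ℤ) : ℂ) * vertex (c + 1) * conj z := by
  have hs := int_units_cast_mul_self (R := ℂ) s
  have hsn : ‖((s : ℤ) : ℂ)‖ = 1 := by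
    rcases Int.units_eq_one_or s with rfl | rfl <;> simp
  have hmem : F (((s : ℤ) : ℂ) * vertex 0) ∈ halfPentagon 1 :=
    hF ▸ Set.mem_image_of_mem F (mem_halfPentagon s 0)
  obtain ⟨k, hk⟩ := exists_eq_vertex_of_mem_halfPentagon hmem (by
    rw [F.norm_map, norm_mul, hsn, norm_vertex, one_mul])
  obtain ⟨a, rfl | rfl⟩ := linear_isometry_complex F
  · refine ⟨1, k, Or.inl ⟨rfl, fun z => ?_⟩⟩
    rw [rotation_apply, vertex_zero] at hk
    rw [rotation_apply, ← hk]
    linear_combination (-(a : ℂ) * z) * hs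
  · refine ⟨-1, k - 1, Or.inr ⟨rfl, fun z => ?_⟩⟩
    rw [LinearIsometryEquiv.trans_apply, rotation_apply, vertex_zero, Complex.conjLIE_apply,
      mul_one, map_intCast] at hk
    rw [LinearIsometryEquiv.trans_apply, rotation_apply, Complex.conjLIE_apply, sub_add_cancel,
      ← hk]
    linear_combination (-(a : ℂ) * conj z) * hs

theorem mem_halfSide {s : ℤˣ} {k : ZMod 5} {z : ℂ} :
    z ∈ halfSide s k ↔ ((s : ℤ) : ℂ) * z ∈ side k := by
  have hs := int_units_cast_mul_self (R := ℂ) s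
  constructor
  · rintro ⟨w, hw, rfl⟩
    simpa [← mul_assoc, hs] using hw
  · intro h
    exact ⟨_, h, by simp only [← mul_assoc, hs, one_mul]⟩

/-- After multiplication by the sign of its half, gluing becomes the point reflection in the
midpoint of the edge. -/
theorem glue_mem_halfSide {s : ℤˣ} {k : ZMod 5} {z : ℂ} (hz : z ∈ halfSide s k) :
    glue s k z ∈ halfSide (-s) k := by
  have hs := int_units_cast_mul_self (R := ℂ) s
  rw [mem_halfSide] at hz ⊢
  have h2 : ((-s : ℤˣ) : ℤ) * glue s k z = 2 * sideMid k - (s : ℤ) * z := by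
    rw [glue]
    push_cast
    linear_combination 2 * sideMid k * hs
  rw [h2]
  obtain ⟨a, b, ha, hb, hab, h⟩ := mem_side.1 hz
  refine mem_side.2 ⟨b, a, hb, ha, by rw [add_comm, hab], ?_⟩
  rw [← h, sideMid_eq, vertex_add]
  obtain rfl := eq_sub_of_add_eq hab
  simp only [Complex.real_smul]
  push_cast
  ring

theorem fold_mem_side {F : ℂ ≃ₗᵢ[ℝ] ℂ} {s : ℤˣ} {σ c : ZMod 5}
    (h : σ = 1 ∧ (∀ z, F z = ((s : ℤ) : ℂ) * vertex c * z) ∨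
      σ = -1 ∧ ∀ z, F z = ((s : ℤ) : ℂ) * vertex (c + 1) * conj z)
    {k : ZMod 5} {z : ℂ} (hz : z ∈ halfSide s k) : F z ∈ side (σ * k + c) := by
  rw [mem_halfSide] at hz
  rcases h with ⟨rfl, h⟩ | ⟨rfl, h⟩
  · have := mul_mem_side c hz
    rw [h, one_mul]
    convert this using 1
    ring
  · have := conj_mem_side c hz
    rw [h, show -1 * k + c = c - k by ring]
    convert this using 1
    rw [map_mul, map_intCast]
    ring

/-- Consecutive folds cannot have the same orientation. The midpoint of the glued edge forces `κ =
-1`, and then any other point of the edge is mapped where the midpoint is, against injectivity. -/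
theorem false_of_fold_eq_mul {F F' : ℂ ≃ₗᵢ[ℝ] ℂ} {s : ℤˣ} {k : ZMod 5} {κ : ℂ}
    (h : ∀ z, F' z = κ * F z) (hg : ∀ z ∈ halfSide s k, F' (glue s k z) = F z) : False := by
  have hs := int_units_cast_mul_self (R := ℂ) s
  have hs0 : ((s : ℤ) : ℂ) ≠ 0 := left_ne_zero_of_mul_eq_one hs
  have h0 := hg (((s : ℤ) : ℂ) * sideMid k) ⟨_, sideMid_mem_side k, rfl⟩
  have hm0 : ((s : ℤ) : ℂ) * sideMid k ≠ 0 := by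
    refine mul_ne_zero hs0 fun h1 => ?_
    have h2 := height_of_mem_side (sideMid_mem_side k)
    rw [h1, map_zero, maxHeight] at h2
    linarith [re_vertex_one_pos]
  have hκ : κ = -1 := by
    rw [glue, h, show ((s : ℤ) : ℂ) * sideMid k - 2 * (((s : ℤ) : ℂ) * sideMid k) =
      -(((s : ℤ) : ℂ) * sideMid k) by ring, map_neg] at h0
    have h1 : F (((s : ℤ) : ℂ) * sideMid k) ≠ 0 := fun h2 => hm0 (by simpa using h2)
    apply mul_right_cancel₀ h1
    linear_combination -h0
  -- Any point of the edge other than its midpoint would do.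
  have hy : (3 / 4 : ℝ) • vertex k + (1 / 4 : ℝ) • vertex (k + 1) ∈ side k :=
    mem_side.2 ⟨3 / 4, 1 / 4, by norm_num, by norm_num, by norm_num, rfl⟩
  have h1 := hg _ ⟨_, hy, rfl⟩
  simp only [glue] at h1
  rw [h, hκ, map_sub, show ∀ w : ℂ, (2 : ℂ) * w = w + w from fun w => two_mul w, map_add] at h1
  have h2 := F.injective (a₁ := ((s : ℤ) : ℂ) * ((3 / 4 : ℝ) • vertex k +
    (1 / 4 : ℝ) • vertex (k + 1))) (a₂ := ((s : ℤ) : ℂ) * sideMid k) (by linear_combination -h1 / 2)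
  have h3 := mul_left_cancel₀ hs0 h2
  rw [sideMid_eq, vertex_add, Complex.real_smul, Complex.real_smul] at h3
  push_cast at h3
  have h4 : vertex k * (vertex 1 - 1) = 0 := by linear_combination -4 * h3
  exact mul_ne_zero (vertex_ne_zero k) vertex_one_sub_one_ne_zero h4

/-- Folding turns the increments of the cutting sequence into those of the billiard sequence, up to
alternating signs. -/
theorem DoublePentagonTrajectory.FoldsTo.exists_sign {τ : DoublePentagonTrajectory}
    {γ : BilliardTrajectory} (h : τ.FoldsTo γ) :
    ∃ σ : ℤ → ZMod 5, (∀ n, σ n * σ n = 1) ∧ (∀ n, σ (n + 1) = -σ n) ∧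
      ∀ n, γ.edge (n + 1) - γ.edge n = σ n * (τ.edge (n + 1) - τ.edge n) := by
  obtain ⟨F, hF, hglue, hentry⟩ := h
  choose σ c hσc using fun n => fold_eq (hF n)
  have he : ∀ n, γ.edge n = σ n * τ.edge n + c n := fun n =>
    eq_of_mem_side (γ.point_mem n) (hentry n ▸ fold_mem_side (hσc n) (τ.entry_mem n))
  refine ⟨σ, fun n => ?_, fun n => ?_, fun n => ?_⟩
  · rcases hσc n with ⟨h, -⟩ | ⟨h, -⟩ <;> rw [h] <;> ring
  · have hs := int_units_cast_mul_self (R := ℂ) (τ.half n)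
    have key : ∀ a b : ZMod 5, ((τ.half (n + 1) : ℤ) : ℂ) * vertex a =
        -vertex (a - b) * (((τ.half n : ℤ) : ℂ) * vertex b) := by
      intro a b
      rw [τ.half_succ, vertex_sub]
      push_cast
      linear_combination ((τ.half n : ℤ) : ℂ) * vertex a * vertex_mul_vertex_neg b
    rcases hσc n with ⟨h, hz⟩ | ⟨h, hz⟩ <;> rcases hσc (n + 1) with ⟨h', hz'⟩ | ⟨h', hz'⟩
    · exact (false_of_fold_eq_mul (fun z => by rw [hz, hz', key _ (c n), mul_assoc])
        (hglue n)).elim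
    · rw [h, h']
    · rw [h, h', neg_neg]
    · exact (false_of_fold_eq_mul (fun z => by rw [hz, hz', key _ (c n + 1), mul_assoc])
        (hglue n)).elim
  -- The two folds agree on the midpoint of the crossed edge, so the table edge reached can be
  -- computed with the fold before the crossing.
  · have hmid : ((τ.half n : ℤ) : ℂ) * sideMid (τ.edge (n + 1)) ∈
        halfSide (τ.half n) (τ.edge (n + 1)) := ⟨_, sideMid_mem_side _, rfl⟩
    have h1 := fold_mem_side (hσc n) hmid
    have h2 := glue_mem_halfSide hmid
    rw [← τ.half_succ] at h2
    have h3 := fold_mem_side (hσc (n + 1)) h2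
    rw [hglue n _ hmid, ← he] at h3
    rw [eq_of_mem_side h3 h1, he n]
    ring

/-! ### Unfolding a billiard trajectory -/

theorem exists_int_antidifference {A : Type*} [AddCommGroup A] (d : ℤ → A) :
    ∃ f : ℤ → A, ∀ n, f (n + 1) = f n + d n := by
  refine ⟨fun n => Int.rec (fun m => ∑ i ∈ Finset.range m, d i)
    (fun m => -∑ i ∈ Finset.range (m + 1), d (Int.negSucc i)) n, fun n => ?_⟩
  rcases n with m | m
  · exact Finset.sum_range_succ _ _
  · rcases m with _ | m
    · change (0 : A) = -∑ i ∈ Finset.range (0 + 1), d (Int.negSucc i) + d (Int.negSucc 0)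
      simp
    · have h : Int.negSucc (m + 1) + 1 = Int.negSucc m := rfl
      rw [h]
      simp only [Finset.sum_range_succ _ (m + 1)]
      abel

theorem vertex_mem_unitSphere (k : ZMod 5) : vertex k ∈ Submonoid.unitSphere ℂ :=
  mem_sphere_zero_iff_norm.2 (norm_vertex k)

/-- The isometry that lays `halfPentagon s` onto the table and the edge with label `k` onto the
edge with number `s * k + c`. -/
noncomputable def foldMap (s : ℤˣ) (c : ZMod 5) : ℂ ≃ₗᵢ[ℝ] ℂ :=
  if s = 1 then rotation ⟨vertex c, vertex_mem_unitSphere c⟩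
  else (Complex.conjLIE.trans (rotation ⟨vertex (c + 1), vertex_mem_unitSphere (c + 1)⟩)).trans
    (LinearIsometryEquiv.neg ℝ)

theorem foldMap_one (c : ZMod 5) (z : ℂ) : foldMap 1 c z = vertex c * z := by
  rw [foldMap, if_pos rfl]
  rfl

theorem foldMap_neg_one (c : ZMod 5) (z : ℂ) : foldMap (-1) c z = -(vertex (c + 1) * conj z) := by
  rw [foldMap, if_neg (by decide)]
  rfl

theorem foldMap_vertex (s : ℤˣ) (c : ZMod 5) : ∃ π : Equiv.Perm (ZMod 5),
    ∀ k, foldMap s c (((s : ℤ) : ℂ) * vertex k) = vertex (π k) := by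
  rcases Int.units_eq_one_or s with rfl | rfl
  · refine ⟨Equiv.addLeft c, fun k => ?_⟩
    rw [foldMap_one, Equiv.coe_addLeft, vertex_add]
    simp
  · refine ⟨Equiv.subLeft (c + 1), fun k => ?_⟩
    rw [foldMap_neg_one, Equiv.subLeft_apply, vertex_sub, map_mul, conj_vertex]
    simp

theorem foldMap_image (s : ℤˣ) (c : ZMod 5) : foldMap s c '' halfPentagon s = halfPentagon 1 := by
  obtain ⟨π, hπ⟩ := foldMap_vertex s c
  have h := LinearMap.image_convexHull ((foldMap s c).toLinearEquiv : ℂ →ₗ[ℝ] ℂ)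
    (Set.range fun k : ZMod 5 => ((s : ℤ) : ℂ) * vertex k)
  rw [halfPentagon, halfPentagon]
  refine h.trans ?_
  congr 1
  rw [← Set.range_comp, ← π.surjective.range_comp fun k => (((1 : ℤˣ) : ℤ) : ℂ) * vertex k]
  congr 1
  funext k
  change foldMap s c _ = _
  rw [hπ]
  simp

theorem foldMap_sideMid (s : ℤˣ) (c k : ZMod 5) :
    foldMap s c (((s : ℤ) : ℂ) * sideMid k) = sideMid (((s : ℤ) : ZMod 5) * k + c) := by
  rcases Int.units_eq_one_or s with rfl | rfl
  · rw [foldMap_one, sideMid_eq, sideMid_eq]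
    push_cast
    rw [one_mul, one_mul, vertex_add]
    ring
  · rw [foldMap_neg_one, sideMid_eq, sideMid_eq]
    push_cast
    rw [show -1 * k + c = c + -k by ring, vertex_add c 1, vertex_add c (-k)]
    simp only [map_mul, map_neg, map_div₀, map_add, map_one, conj_vertex, Complex.conj_ofNat]
    linear_combination vertex c * vertex (-k) / 2 * vertex_mul_vertex_neg 1

theorem foldMap_symm_mem {s : ℤˣ} {c k : ZMod 5} {z : ℂ}
    (hz : z ∈ side (((s : ℤ) : ZMod 5) * k + c)) : (foldMap s c).symm z ∈ halfSide s k := by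
  obtain ⟨w, rfl⟩ := (foldMap s c).surjective z
  rw [LinearIsometryEquiv.symm_apply_apply, mem_halfSide]
  rcases Int.units_eq_one_or s with rfl | rfl
  · have h := mul_mem_side (-c) hz
    rw [foldMap_one, ← mul_assoc, ← vertex_add, neg_add_cancel, vertex_zero] at h
    simpa using h
  · have h := conj_mem_side c hz
    rw [foldMap_neg_one, map_neg, map_mul, conj_vertex, Complex.conj_conj, mul_neg, ← mul_assoc,
      vertex_mul_vertex_neg] at h
    simpa using h

/-- Crossing the edge with label `k` composes the folding map with a reflection. -/
theorem foldMap_neg (s : ℤˣ) (c k : ZMod 5) (z : ℂ) :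
    foldMap (-s) (c + 2 * (((s : ℤ) : ZMod 5) * k)) z =
      edgeRefl (((s : ℤ) : ZMod 5) * k + c) (foldMap s c z) := by
  rcases Int.units_eq_one_or s with rfl | rfl
  · rw [foldMap_neg_one, foldMap_one, edgeRefl, map_mul, conj_vertex]
    push_cast
    rw [show c + 2 * (1 * k) + 1 = 2 * (1 * k + c) + 1 + -c by ring, vertex_add _ (-c)]
    ring
  · rw [neg_neg, foldMap_neg_one, foldMap_one, edgeRefl, map_neg, map_mul, conj_vertex,
      Complex.conj_conj]
    push_cast
    rw [show c + 2 * (-1 * k) = 2 * (-1 * k + c) + 1 + -(c + 1) by ring, vertex_add _ (-(c + 1))]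
    ring

theorem foldMap_neg_glue {s : ℤˣ} {c k : ZMod 5} {z : ℂ}
    (hz : foldMap s c z ∈ side (((s : ℤ) : ZMod 5) * k + c)) :
    foldMap (-s) (c + 2 * (((s : ℤ) : ZMod 5) * k)) (glue s k z) = foldMap s c z := by
  rw [foldMap_neg, glue, two_mul, map_sub, map_add, foldMap_sideMid, ← two_mul,
    edgeRefl_sub_two_sideMid hz]

theorem foldMap_mem_side {s : ℤˣ} {c k : ZMod 5} {z : ℂ} (hz : z ∈ halfSide s k) :
    foldMap s c z ∈ side (((s : ℤ) : ZMod 5) * k + c) := by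
  refine fold_mem_side ?_ hz
  rcases Int.units_eq_one_or s with rfl | rfl
  · left
    simp [foldMap_one]
  · right
    simp [foldMap_neg_one]

theorem exists_foldsTo (γ : BilliardTrajectory) : ∃ τ : DoublePentagonTrajectory, τ.FoldsTo γ := by
  set s : ℤ → ℤˣ := fun n => (-1) ^ n with hs
  have hsucc : ∀ n, s (n + 1) = -s n := fun n => by rw [hs]; simp only [zpow_add_one]; simp
  have hsq : ∀ n, ((s n : ℤ) : ZMod 5) * ((s n : ℤ) : ZMod 5) = 1 := fun n =>
    int_units_cast_mul_self _
  obtain ⟨f, hf⟩ := exists_int_antidifference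
    fun n => ((s n : ℤ) : ZMod 5) * (γ.edge (n + 1) - γ.edge n)
  -- Chosen so that the fold lays label `f n` on edge `γ.edge n`; by the choice of `f` it also lays
  -- `f (n + 1)` on `γ.edge (n + 1)`.
  set c : ℤ → ZMod 5 := fun n => γ.edge n - ((s n : ℤ) : ZMod 5) * f n with hc
  have he : ∀ n, ((s n : ℤ) : ZMod 5) * f n + c n = γ.edge n := fun n => by
    simp only [hc]
    ring
  have he' : ∀ n, ((s n : ℤ) : ZMod 5) * f (n + 1) + c n = γ.edge (n + 1) := fun n => by
    simp only [hc]
    linear_combination ((s n : ℤ) : ZMod 5) * hf n + (γ.edge (n + 1) - γ.edge n) * hsq n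
  have hcs : ∀ n, c (n + 1) = c n + 2 * (((s n : ℤ) : ZMod 5) * f (n + 1)) := fun n => by
    have h1 := he (n + 1)
    rw [← he' n, hsucc] at h1
    push_cast at h1
    linear_combination h1
  set F : ℤ → (ℂ ≃ₗᵢ[ℝ] ℂ) := fun n => foldMap (s n) (c n) with hF
  have hFs : ∀ n z, F (n + 1) z = edgeRefl (γ.edge (n + 1)) (F n z) := fun n z => by
    simp only [hF]
    rw [hsucc, hcs, foldMap_neg, he']
  have hglue : ∀ n, ∀ z ∈ halfSide (s n) (f (n + 1)),
      F (n + 1) (glue (s n) (f (n + 1)) z) = F n z := fun n z hz => by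
    simp only [hF]
    rw [hsucc, hcs, foldMap_neg_glue (foldMap_mem_side hz)]
  have hexit : ∀ n, (F n).symm (γ.point (n + 1)) ∈ halfSide (s n) (f (n + 1)) := fun n =>
    foldMap_symm_mem (by rw [he']; exact γ.point_mem _)
  -- The reflection in passing from `F n` to `F (n + 1)` cancels the one at the bounce, so the
  -- unfolded direction is constant.
  have hdir : ∀ n, (F n).symm (γ.unitDir n) = (F 0).symm (γ.unitDir 0) :=
    forall_int_of_iff_succ (fun n => by
      have : (F (n + 1)).symm (γ.unitDir (n + 1)) = (F n).symm (γ.unitDir n) := by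
        rw [LinearIsometryEquiv.symm_apply_eq, hFs, LinearIsometryEquiv.apply_symm_apply,
          γ.unitDir_succ]
      rw [this]) rfl
  refine ⟨{
    dir := (F 0).symm (γ.unitDir 0)
    dir_ne := by simpa using γ.unitDir_ne_zero 0
    half := s
    edge := f
    entry := fun n => (F n).symm (γ.point n)
    exit := fun n => (F n).symm (γ.point (n + 1))
    edge_ne := fun n h => γ.edge_ne n (by rw [← he' n, h, he n])
    entry_mem := fun n => foldMap_symm_mem (by rw [he]; exact γ.point_mem _)
    exit_mem := hexit
    direction := fun n => by
      rw [← map_sub, γ.point_sub_eq, map_smul, hdir n]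
      exact (SameRay.refl (R := ℝ) ((F 0).symm (γ.unitDir 0))).pos_smul_right (γ.stepLength_pos n)
    half_succ := hsucc
    entry_succ := fun n => by
      rw [LinearIsometryEquiv.symm_apply_eq, hglue n _ (hexit n),
        LinearIsometryEquiv.apply_symm_apply] },
    F, fun n => foldMap_image _ _, hglue, fun n => LinearIsometryEquiv.apply_symm_apply _ _⟩

end PentagonBilliard

/-! ### The theorem -/

theorem mainTheorem9
    (γ : PentagonBilliard.BilliardTrajectory)
    (hper : γ.IsPeriodic) (hsym : γ.IsRotationallySymmetric) :
    (∃ τ : PentagonBilliard.DoublePentagonTrajectory, τ.FoldsTo γ) ∧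
    ∀ τ : PentagonBilliard.DoublePentagonTrajectory, τ.FoldsTo γ →
      (¬ γ.IsParallelToEdge →
        γ.combLength = 5 * τ.wordLength ∧ γ.sequenceLength = 5 * τ.wordLength) ∧
      (γ.IsParallelToEdge →
        2 * γ.sequenceLength = 5 * τ.wordLength ∧
        (γ.HitsMidpoint → 2 * γ.combLength = 5 * τ.wordLength) ∧
        (¬ γ.HitsMidpoint → γ.combLength = 5 * τ.wordLength)) := by
  refine ⟨PentagonBilliard.exists_foldsTo γ, fun τ hτ => ?_⟩
  obtain ⟨σ, hσ, hσ', hf⟩ := hτ.exists_sign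
  refine ⟨fun hn => ?_, fun hp => ?_⟩
  · obtain ⟨m, hm⟩ := γ.exists_shift_eq_rotate hsym
    exact PentagonBilliard.BilliardTrajectory.lengths_of_not_isParallelToEdge hper hn
      (fun n => PentagonBilliard.BilliardTrajectory.edge_eq_of_point_eq (γ' := γ.rotate 1) (hm n))
      hσ hσ' hf
  · have hl : τ.wordLength = 2 := hp.seqPeriod_unfolded hσ hσ' hf
    rw [hl, hp.sequenceLength_eq]
    refine ⟨rfl, fun h => ?_, fun h => ?_⟩
    · rw [hp.combLength_of_hitsMidpoint h]
    · rw [hp.combLength_of_not_hitsMidpoint h]
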